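/- **Setting.** Let $d\in\{2,3\}$ and let $\mathcal O\subset\mathbb R^d$ be a bounded open convex polyhedral domain. Let $\mathcal K_h$ be a finite conforming partition of $\overline{\mathcal O}$ into convex polytopes (e.g. simplices) with non-empty, pairwise disjoint interiors, such that each $(d-1)$-dimensional face of a cell lies on $\partial\mathcal O$ or is also a face of another cell, and let it be shape-regular: $h_K/\rho_K\le\rho$ for all $K$, with $h_K=\operatorname{diam}K$ and $\rho_K$ the radius of the largest ball inscribed in $K$. Let $\mathcal F_h=\mathcal F_h^i\cup\mathcal F_h^b$ be the set of interior and boundary faces, and $h_F=|F|^{1/(d-1)}$. On $F\in\mathcal F_h^i$ a unit normal $\mathbf n_F$ pointing from one adjacent cell $K_F^1$ to the other one $K_F^2$ is fixed, and $[w]=w|_{K_F^1}-w|_{K_F^2}$, $\{w\}=\frac12(w|_{K_F^1}+w|_{K_F^2})$; on $F\in\mathcal F_h^b$, $\mathbf n_F$ is the outward normal and $[w]=\{w\}=w$. On $\partial K$, $\mathbf n_K$ is the outward normal, and $w^{\rm int}$, $w^{\rm ext}$ are the traces from inside and outside $K$, with $w^{\rm ext}=0$ on $\partial\mathcal O$.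 Let $r_1\ge1$, $r_2\ge0$ be integers with $r_1-1\le r_2\le r_1+1$. Let $\mathbf M_h$ be the space of vector fields that are in $(\mathbb P_{r_1}(K))^d$ on each $K\in\mathcal K_h$, $P_h$ the space of functions that are in $\mathbb P_{r_2}(K)$ on each $K$, and $P_h^0=\{g\in P_h:\int_{\mathcal O}g=0\}$. Let $(\cdot,\cdot)$ be the $L^2(\mathcal O)$ inner product, $\epsilon\in\{-1,0,1\}$, $\sigma,\tilde\sigma>0$, and $$\begin{aligned} \mathcal A_c(\boldsymbol\theta;\mathbf z,\boldsymbol\varphi,\mathbf w)&=\sum_K\int_K\Big((\mathbf z\cdot\nabla\boldsymbol\varphi)\cdot\mathbf w+\tfrac12(\nabla\cdot\mathbf z)\,\boldsymbol\varphi\cdot\mathbf w\Big)-\tfrac12\sum_{F\in\mathcal F_h}\int_F[\mathbf z]\cdot\mathbf n_F\{\boldsymbol\varphi\cdot\mathbf w\}\\ &\quad+\sum_K\int_{\partial K_-^{\boldsymbol\theta}}|\{\mathbf z\}\cdot\mathbf n_K|(\boldsymbol\varphi^{\rm int}-\boldsymbol\varphi^{\rm ext})\cdot\mathbf w^{\rm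 int},\qquad \partial K_-^{\boldsymbol\theta}=\{x\in\partial K:\{\boldsymbol\theta\}\cdot\mathbf n_K<0\},\\ \mathcal A_\epsilon(\mathbf u,\mathbf w)&=\sum_K\int_K\nabla\mathbf u:\nabla\mathbf w-\sum_{F\in\mathcal F_h}\int_F\{\nabla\mathbf u\}\mathbf n_F\cdot[\mathbf w]+\epsilon\sum_{F\in\mathcal F_h}\int_F\{\nabla\mathbf w\}\mathbf n_F\cdot[\mathbf u]+\sum_{F\in\mathcal F_h}\frac{\sigma}{h_F}\int_F[\mathbf u]\cdot[\mathbf w],\\ b(\mathbf w,g)&=\sum_K\int_K(\nabla\cdot\mathbf w)g-\sum_{F\in\mathcal F_h}\int_F\{g\}\,\mathbf n_F\cdot[\mathbf w],\\ \mathcal A_{\rm sip}(v,g)&=\sum_K\int_K\nabla v\cdot\nabla g-\sum_{F\in\mathcal F_h^i}\int_F\big(\{\nabla v\}\cdot\mathbf n_F[g]+\{\nabla g\}\cdot\mathbf n_F[v]\big)+\sum_{F\in\mathcal F_h^i}\frac{\tilde\sigma}{h_F}\int_F[v][g], \end{aligned}$$ with $\mathcal A_d=\mathcal A_{-1}$ the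 symmetric form. Put $\|\mathbf w\|_{\rm dG}^2=\sum_K\|\nabla\mathbf w\|_{L^2(K)}^2+\sum_{F\in\mathcal F_h}\frac{\sigma}{h_F}\|[\mathbf w]\|_{L^2(F)}^2$ and $|g|_{\rm dG}^2=\sum_K\|\nabla g\|_{L^2(K)}^2+\sum_{F\in\mathcal F_h^i}\frac{\tilde\sigma}{h_F}\|[g]\|_{L^2(F)}^2$. Let $\mu,\gamma,\eta,\delta>0$, $\beta(t)=\gamma e^{-\eta t}$, let $\tau>0$ be the time step, $t_j=j\tau$, and $q_r^n(\boldsymbol\varphi)=\tau\sum_{j=1}^n\beta(t_n-t_j)\boldsymbol\varphi^j$. For $n\ge1$, given $\mathbf f^n\in L^2(\mathcal O)^d$, $\mathbf u_h^{n-1}\in\mathbf M_h$, $p_h^{n-1}\in P_h^0$ and the earlier intermediate velocities $\widetilde{\mathbf u}_h^1,\dots,\widetilde{\mathbf u}_h^{n-1}\in\mathbf M_h$, step $n$ of the scheme asks for $\widetilde{\mathbf u}_h^n,\mathbf u_h^n\in\mathbf M_h$ and $p_h^n\in P_h^0$ such that, with some $v_h^n\in P_h^0$, $$\begin{aligned}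 &(\widetilde{\mathbf u}_h^n,\mathbf w)+\tau\mathcal A_c(\mathbf u_h^{n-1};\mathbf u_h^{n-1},\widetilde{\mathbf u}_h^n,\mathbf w)+\tau\mu\mathcal A_\epsilon(\widetilde{\mathbf u}_h^n,\mathbf w)+\tau\mathcal A_\epsilon(q_r^n(\widetilde{\mathbf u}_h),\mathbf w)=(\mathbf u_h^{n-1},\mathbf w)+\tau b(\mathbf w,p_h^{n-1})+\tau(\mathbf f^n,\mathbf w)&&\forall\,\mathbf w\in\mathbf M_h,\\ &\mathcal A_{\rm sip}(v_h^n,g)=-\tfrac1\tau b(\widetilde{\mathbf u}_h^n,g)&&\forall\,g\in P_h^0,\\ &(p_h^n,g)=(p_h^{n-1},g)+(v_h^n,g)-\delta\mu\,b(\widetilde{\mathbf u}_h^n,g)-\delta\,b(q_r^n(\widetilde{\mathbf u}_h),g)&&\forall\,g\in P_h,\\ &(\mathbf u_h^n,\mathbf w)=(\widetilde{\mathbf u}_h^n,\mathbf w)+\tau b(\mathbf w,v_h^n)&&\forall\,\mathbf w\in\mathbf M_h. \end{aligned}$$ The penalty parameters are assumed to be such that $$\mathcal A_\epsilon(\mathbf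 w,\mathbf w)\ge\omega\|\mathbf w\|_{\rm dG}^2\ \ \forall\,\mathbf w\in\mathbf M_h,\qquad \mathcal A_{\rm sip}(g,g)\ge\tfrac12|g|_{\rm dG}^2\ \ \forall\,g\in P_h,\tag{$*$}$$ with $\omega=1$ if $\epsilon=1$ and $\omega=\frac12$ if $\epsilon\in\{-1,0\}$. **Lemma 2 (existence and uniqueness of the discrete solution).** 1. Condition $(*)$ holds for sufficiently large penalty parameters: there is $\sigma_0>0$, depending only on $d,r_1,r_2,\rho$, such that the first inequality holds if $\epsilon=1$ (for every $\sigma>0$) and if $\epsilon\in\{-1,0\}$ and $\sigma\ge\sigma_0$, and the second one holds if $\tilde\sigma\ge\sigma_0$. 2. For the symmetric form $\mathcal A_d$ ($\epsilon=-1$), under $(*)$, for every $\tau>0$, every $n\ge1$ and all data as above, there is a unique solution $(\widetilde{\mathbf u}_h^n,\mathbf u_h^n,p_h^n)\in\mathbf M_h\times\mathbf M_h\times P_h^0$ of step $n$. 3. For a nonsymmetric form $\mathcal A_\epsilon$ ($\epsilon\in\{0,1\}$) there is $\tau_0>0$, depending only on $d,r_1,r_2,\rho,\epsilon,\mu,\gamma,\eta,\delta,\sigma,\tilde\sigma$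 (not on the domain, the mesh, $n$ or the data), such that under $(*)$, for every $0<\tau<\tau_0$, every $n\ge1$ and all data as above, there is a unique solution $(\widetilde{\mathbf u}_h^n,\mathbf u_h^n,p_h^n)\in\mathbf M_h\times\mathbf M_h\times P_h^0$ of step $n$. -/

import Mathlib

noncomputable section

namespace DGOldroyd

open MeasureTheory
open scoped RealInnerProductSpace

/-- Euclidean space `ℝ^d`. -/
abbrev E (d : ℕ) := EuclideanSpace ℝ (Fin d)

/-! ### Domain and mesh -/

/-- A bounded convex polytope: a bounded intersection of finitely many closed half-spaces. -/
def IsConvexPolytope {d : ℕ} (K : Set (E d)) : Prop :=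
  Bornology.IsBounded K ∧
    ∃ S : Finset (E d × ℝ), K = {x | ∀ s ∈ S, ⟪s.1, x⟫ ≤ s.2}

/-- An open, bounded, convex, polyhedral domain. -/
structure IsConvexPolyhedralDomain {d : ℕ} (O : Set (E d)) : Prop where
  isOpen : IsOpen O
  nonempty : O.Nonempty
  convex : Convex ℝ O
  polytope : IsConvexPolytope (closure O)

/-- `S` is a facet (a face of dimension `d - 1`) of `K`, and `n` is the unit normal to `S` that
points out of `K`. -/
def IsFacet {d : ℕ} (K S : Set (E d)) (n : E d) : Prop :=
  ‖n‖ = 1 ∧ Module.finrank ℝ (vectorSpan ℝ S) + 1 = d ∧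
    ∃ b : ℝ, (∀ x ∈ K, ⟪n, x⟫ ≤ b) ∧ S = {x ∈ K | ⟪n, x⟫ = b}

/-- A finite conforming partition of `O` into convex polytopes (simplices, for instance), with its
set of faces and a choice of a unit normal on every face. The face `F` lies on the cell `fst F`,
and the normal of `F` points out of `fst F`. If `snd F = some K`, then `F` is an interior face, and
its normal points from `fst F` to `K`; if `snd F = none`, then `F` is a boundary face. -/
structure Mesh {d : ℕ} (O : Set (E d)) where
  /-- index set of the cells -/
  Cell : Type
  /-- index set of the faces -/
  Face : Type
  [fintypeCell : Fintype Cell]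
  [fintypeFace : Fintype Face]
  /-- the closed set that a cell occupies -/
  cell : Cell → Set (E d)
  /-- the closed set that a face occupies -/
  face : Face → Set (E d)
  /-- the chosen unit normal of a face -/
  normal : Face → E d
  /-- the cell from which the normal points outwards -/
  fst : Face → Cell
  /-- the cell on the other side, if there is one -/
  snd : Face → Option Cell
  cell_polytope : ∀ K, IsConvexPolytope (cell K)
  cell_interior : ∀ K, (interior (cell K)).Nonempty
  cover : ⋃ K, cell K = closure O
  disjoint : ∀ K L, K ≠ L → Disjoint (interior (cell K)) (interior (cell L))
  face_injective : Function.Injective face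
  fst_facet : ∀ F, IsFacet (cell (fst F)) (face F) (normal F)
  snd_facet : ∀ F K, snd F = some K → IsFacet (cell K) (face F) (-normal F)
  boundary : ∀ F, snd F = none → face F ⊆ frontier O
  /-- every facet of every cell is a face of the mesh -/
  facet_mem : ∀ K S n, IsFacet (cell K) S n → ∃ F, face F = S ∧ (fst F = K ∨ snd F = some K)

attribute [instance] Mesh.fintypeCell Mesh.fintypeFace

/-- The radius of the largest ball inscribed in `K`. -/
def inradius {d : ℕ} (K : Set (E d)) : ℝ :=
  sSup {r : ℝ | 0 ≤ r ∧ ∃ x, Metric.closedBall x r ⊆ K}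

namespace Mesh

variable {d : ℕ} {O : Set (E d)} (m : Mesh O)

/-- Shape regularity with parameter `ρ`. -/
def ShapeRegular (ρ : ℝ) : Prop :=
  ∀ K, Metric.diam (m.cell K) / inradius (m.cell K) ≤ ρ

/-! ### Broken functions, jumps and averages

A broken function is given by one function for each cell, of which only the values on that closed
cell matter; its value on the boundary of the cell is the trace from the inside of the cell. -/

/-- broken scalar functions -/
abbrev Scal := m.Cell → E d → ℝ

/-- broken vector fields -/
abbrev Vec := m.Cell → E d → E d

section traces

variable {V : Type*} [AddCommGroup V] [Module ℝ V]

/-- The trace on `F` from the side opposite to `fst F`; zero on a boundary face. -/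
def outer (w : m.Cell → E d → V) (F : m.Face) (x : E d) : V :=
  (m.snd F).elim 0 fun K => w K x

/-- The jump `[w]` on `F`; on a boundary face it is the trace. -/
def jump (w : m.Cell → E d → V) (F : m.Face) (x : E d) : V :=
  w (m.fst F) x - m.outer w F x

/-- The average `{w}` on `F`; on a boundary face it is the trace. -/
def avg (w : m.Cell → E d → V) (F : m.Face) (x : E d) : V :=
  (m.snd F).elim (w (m.fst F) x) fun K => (1 / 2 : ℝ) • (w (m.fst F) x + w K x)

end traces

/-- The integral over a subset `S` of `ℝ^d` with respect to the surface measure of dimension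
`d - 1`. -/
def _root_.DGOldroyd.surfInt {d : ℕ} (S : Set (E d)) (g : E d → ℝ) : ℝ :=
  ∫ x in S, g x ∂(Measure.euclideanHausdorffMeasure (d - 1))

/-- `h_F = |F|^{1/(d-1)}` -/
def hF (F : m.Face) : ℝ :=
  ((Measure.euclideanHausdorffMeasure (d - 1) : Measure (E d)).real (m.face F)) ^
    (1 / ((d : ℝ) - 1))

/-- The set of interior faces. -/
def intFaces : Finset m.Face := Finset.univ.filter fun F => (m.snd F).isSome

/-! ### Differential operators on one cell -/

/-- `∇u : ∇w` -/
def _root_.DGOldroyd.gradDot {d : ℕ} (u w : E d → E d) (x : E d) : ℝ :=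
  ∑ j, ⟪fderiv ℝ u x (EuclideanSpace.single j 1), fderiv ℝ w x (EuclideanSpace.single j 1)⟫

/-- `∇ · w` -/
def _root_.DGOldroyd.div {d : ℕ} (w : E d → E d) (x : E d) : ℝ :=
  ∑ j, (fderiv ℝ w x (EuclideanSpace.single j 1)) j

/-- The broken Jacobian matrix `∇_h w`, as a family of linear maps. -/
def jac (w : m.Vec) : m.Cell → E d → (E d →L[ℝ] E d) := fun K => fderiv ℝ (w K)

/-- The broken gradient `∇_h g`. -/
def grad (g : m.Scal) : m.Vec := fun K x => gradient (g K) x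

/-! ### Scalar products and discrete forms -/

/-- `(u, w)` for broken vector fields -/
def innerVec (u w : m.Vec) : ℝ := ∑ K, ∫ x in m.cell K, ⟪u K x, w K x⟫

/-- `(p, g)` for broken scalar functions -/
def innerScal (p g : m.Scal) : ℝ := ∑ K, ∫ x in m.cell K, p K x * g K x

/-- The inflow boundary part of `F`, seen from `fst F` (`s = 1`) or from the other side
(`s = -1`): the points of `F` with `{θ} · (s n_F) < 0`. -/
def inflow (θ : m.Vec) (F : m.Face) (s : ℝ) : Set (E d) :=
  {x ∈ m.face F | ⟪m.avg θ F x, s • m.normal F⟫ < 0}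

/-- The convection form `A_c(θ; z, φ, w)`. The last two sums are the sum over all cells `K` of
`∫_{∂K_-^θ} |{z} · n_K| (φ^int - φ^ext) · w^int`: a face occurs once for each cell that it
bounds, first with `K = fst F`, then, for an interior face, with the cell on the other side. -/
def Ac (θ z φ w : m.Vec) : ℝ :=
  (∑ K, ((∫ x in m.cell K, ⟪fderiv ℝ (φ K) x (z K x), w K x⟫)
      + (1 / 2) * ∫ x in m.cell K, div (z K) x * ⟪φ K x, w K x⟫))
  - (1 / 2) * ∑ F, surfInt (m.face F) (fun x =>
      ⟪m.jump z F x, m.normal F⟫ * m.avg (fun K y => ⟪φ K y, w K y⟫) F x)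
  + ∑ F, surfInt (m.inflow θ F 1) (fun x =>
      |⟪m.avg z F x, m.normal F⟫| * ⟪φ (m.fst F) x - m.outer φ F x, w (m.fst F) x⟫)
  + ∑ F ∈ m.intFaces, surfInt (m.inflow θ F (-1)) (fun x =>
      |⟪m.avg z F x, m.normal F⟫| * ⟪m.outer φ F x - φ (m.fst F) x, m.outer w F x⟫)

/-- The interior penalty form `A_ε(u, w)` with penalty parameter `σ`. -/
def Aeps (ε σ : ℝ) (u w : m.Vec) : ℝ :=
  (∑ K, ∫ x in m.cell K, gradDot (u K) (w K) x)
  - (∑ F, surfInt (m.face F) fun x => ⟪m.avg (m.jac u) F x (m.normal F), m.jump w F x⟫)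
  + ε * (∑ F, surfInt (m.face F) fun x => ⟪m.avg (m.jac w) F x (m.normal F), m.jump u F x⟫)
  + ∑ F, σ / m.hF F * surfInt (m.face F) fun x => ⟪m.jump u F x, m.jump w F x⟫

/-- The form `b(w, g)`. -/
def b (w : m.Vec) (g : m.Scal) : ℝ :=
  (∑ K, ∫ x in m.cell K, div (w K) x * g K x)
  - ∑ F, surfInt (m.face F) fun x => m.avg g F x * ⟪m.normal F, m.jump w F x⟫

/-- The form `A_sip(v, g)` with penalty parameter `σ'`. -/
def Asip (σ' : ℝ) (v g : m.Scal) : ℝ :=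
  (∑ K, ∫ x in m.cell K, ⟪m.grad v K x, m.grad g K x⟫)
  - (∑ F ∈ m.intFaces, surfInt (m.face F) fun x =>
      ⟪m.avg (m.grad v) F x, m.normal F⟫ * m.jump g F x)
  - (∑ F ∈ m.intFaces, surfInt (m.face F) fun x =>
      ⟪m.avg (m.grad g) F x, m.normal F⟫ * m.jump v F x)
  + ∑ F ∈ m.intFaces, σ' / m.hF F * surfInt (m.face F) fun x => m.jump v F x * m.jump g F x

/-- `‖w‖²_dG` -/
def normSqVec (σ : ℝ) (w : m.Vec) : ℝ :=
  (∑ K, ∫ x in m.cell K, gradDot (w K) (w K) x)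
  + ∑ F, σ / m.hF F * surfInt (m.face F) fun x => ‖m.jump w F x‖ ^ 2

/-- `|g|²_dG` -/
def normSqScal (σ' : ℝ) (g : m.Scal) : ℝ :=
  (∑ K, ∫ x in m.cell K, ‖m.grad g K x‖ ^ 2)
  + ∑ F ∈ m.intFaces, σ' / m.hF F * surfInt (m.face F) fun x => (m.jump g F x) ^ 2

/-! ### Discrete spaces -/

/-- The real polynomial functions on `ℝ^d` of total degree at most `r`. -/
def _root_.DGOldroyd.polyFun (d r : ℕ) : Submodule ℝ (E d → ℝ) where
  carrier := {g | ∃ q : MvPolynomial (Fin d) ℝ, q.totalDegree ≤ r ∧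
    ∀ x, g x = MvPolynomial.eval (fun i => x i) q}
  zero_mem' := ⟨0, by simp, by simp⟩
  add_mem' := by
    rintro g g' ⟨q, hq, h⟩ ⟨q', hq', h'⟩
    exact ⟨q + q', (MvPolynomial.totalDegree_add q q').trans (max_le hq hq'),
      fun x => by simp [h x, h' x]⟩
  smul_mem' := by
    rintro c g ⟨q, hq, h⟩
    exact ⟨c • q, (MvPolynomial.totalDegree_smul_le c q).trans hq,
      fun x => by simp [h x, MvPolynomial.smul_eval]⟩

/-- The velocity space `M_h`: vector fields whose restriction to each cell is a polynomial of
degree at most `r`. The polynomial on a cell is determined by its restriction to the cell, which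
has interior points, and is used to represent that restriction. -/
def Mh (r : ℕ) : Submodule ℝ m.Vec where
  carrier := {w | ∀ K i, (fun x => w K x i) ∈ polyFun d r}
  zero_mem' := fun _ _ => (polyFun d r).zero_mem
  add_mem' := fun h h' K i => (polyFun d r).add_mem (h K i) (h' K i)
  smul_mem' := fun c _ h K i => (polyFun d r).smul_mem c (h K i)

/-- The space `P_h` of scalar functions whose restriction to each cell is a polynomial of degree
at most `r`, represented as in `Mh`. -/
def Ph (r : ℕ) : Submodule ℝ m.Scal where
  carrier := {g | ∀ K, g K ∈ polyFun d r}
  zero_mem' := fun _ => (polyFun d r).zero_mem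
  add_mem' := fun h h' K => (polyFun d r).add_mem (h K) (h' K)
  smul_mem' := fun c _ h K => (polyFun d r).smul_mem c (h K)

/-- The subset `P_h⁰` of the functions in `P_h` whose integral is zero. -/
def Ph0 (r : ℕ) : Set m.Scal := {g | g ∈ m.Ph r ∧ ∑ K, ∫ x in m.cell K, g K x = 0}

/-! ### Coercivity requirements on the penalty parameters -/

/-- The coercivity constant of `A_ε`. -/
def _root_.DGOldroyd.omega (ε : ℝ) : ℝ := if ε = 1 then 1 else 1 / 2

/-- `A_ε(w, w) ≥ ω ‖w‖²_dG` on `M_h`. -/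
def CoerciveVel (r : ℕ) (ε σ : ℝ) : Prop :=
  ∀ w ∈ m.Mh r, omega ε * m.normSqVec σ w ≤ m.Aeps ε σ w w

/-- `A_sip(g, g) ≥ ½ |g|²_dG` on `P_h`. -/
def CoerciveSip (r : ℕ) (σ' : ℝ) : Prop :=
  ∀ g ∈ m.Ph r, 1 / 2 * m.normSqScal σ' g ≤ m.Asip σ' g g

end Mesh

/-! ### The scheme -/

/-- The parameters of the model and of the scheme: viscosity `μ`, memory kernel
`β(t) = γ exp(-η t)`, pressure parameter `δ`, penalty parameters `σ` (of `A_ε`) and `σ'`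
(of `A_sip`). -/
structure Params where
  μ : ℝ
  γ : ℝ
  η : ℝ
  δ : ℝ
  σ : ℝ
  σ' : ℝ
  μ_pos : 0 < μ
  γ_pos : 0 < γ
  η_pos : 0 < η
  δ_pos : 0 < δ
  σ_pos : 0 < σ
  σ'_pos : 0 < σ'

/-- The memory kernel. -/
def Params.β (q : Params) (t : ℝ) : ℝ := q.γ * Real.exp (-q.η * t)

variable {d : ℕ} {O : Set (E d)}

/-- The right rectangle rule `τ ∑_{j=1}^n β(t_n - t_j) φ^j`, where `t_j = j τ`. -/
def Params.quad (q : Params) (τ : ℝ) (n : ℕ) (m : Mesh O) (φ : ℕ → m.Vec) : m.Vec :=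
  τ • ∑ j ∈ Finset.Icc 1 n, q.β (n * τ - j * τ) • φ j

/-- The equations of step `n` of the pressure correction scheme with time step `τ`, right-hand
side `f = f(t_n)` and earlier intermediate velocities `hist j`, `1 ≤ j ≤ n - 1`; the sequence
`Function.update hist n ut` continues these by the new intermediate velocity `ut`. The other data
from step `n - 1` are `u0` and `p0`; the unknowns are `ut`, the potential `v`, `p` and `u`. -/
structure IsStepSolution (m : Mesh O) (r₁ r₂ : ℕ) (q : Params) (ε τ : ℝ) (n : ℕ)
    (f : E d → E d) (hist : ℕ → m.Mh r₁) (u0 : m.Mh r₁) (p0 : m.Ph0 r₂)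
    (ut u : m.Mh r₁) (p v : m.Ph0 r₂) : Prop where
  velocity : ∀ w ∈ m.Mh r₁,
    m.innerVec ut w + τ * m.Ac u0 u0 ut w + τ * q.μ * m.Aeps ε q.σ ut w
      + τ * m.Aeps ε q.σ (q.quad τ n m fun j => Function.update hist n ut j) w
    = m.innerVec u0 w + τ * m.b w p0 + τ * m.innerVec (fun _ => f) w
  potential : ∀ g ∈ m.Ph0 r₂, m.Asip q.σ' v g = -(1 / τ) * m.b ut g
  pressure : ∀ g ∈ m.Ph r₂,
    m.innerScal p g = m.innerScal p0 g + m.innerScal v g - q.δ * q.μ * m.b ut g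
      - q.δ * m.b (q.quad τ n m fun j => Function.update hist n ut j) g
  correction : ∀ w ∈ m.Mh r₁, m.innerVec u w = m.innerVec ut w + τ * m.b w v

/-- Unique solvability of step `n` in `M_h × M_h × P_h⁰`, for every right-hand side in
`L²(O)^d` and all data from the earlier steps. -/
def UniquelySolvable (m : Mesh O) (r₁ r₂ : ℕ) (q : Params) (ε τ : ℝ) (n : ℕ) : Prop :=
  ∀ f : E d → E d, MemLp f 2 (volume.restrict O) →
    ∀ (hist : ℕ → m.Mh r₁) (u0 : m.Mh r₁) (p0 : m.Ph0 r₂),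
      ∃! s : m.Mh r₁ × m.Mh r₁ × m.Ph0 r₂,
        ∃ v : m.Ph0 r₂, IsStepSolution m r₁ r₂ q ε τ n f hist u0 p0 s.1 s.2.1 s.2.2 v

end DGOldroyd

end

/-! A polytope is the union of the cones that its facets span with the centre of an inscribed ball,
so integrals over it become integrals along rays. Differentiating the integrand `t^d g` along the
rays gives a radial identity, and the difference of two such identities with distinct centres is the
divergence theorem; the inequality `P(1)² ≤ C ∫₀¹ t^(d-1) P²` for polynomials of one variable gives
the discrete trace inequality. By shape regularity, `h_F` is bounded by a multiple of the radius of
the inscribed ball, so large penalties absorb the consistency terms of `A_ε` and `A_sip`.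

For the scheme, upwinding and the divergence theorem make `A_c(z; z, φ, φ)` nonnegative, and
`q_r^n` adds only the multiple `τ γ ũ^n` of the unknown to the argument of the viscous form. Each
equation of a step is then a linear system with a definite form on a finite-dimensional space,
whatever the size of `τ`. For the potential, definiteness on mean-zero functions means that a broken
constant without jumps is constant on the connected set `O`; for the pressure, testing with `1`
shows that the mean stays zero. -/

noncomputable section

namespace DGOldroyd

open MeasureTheory Module Set
open scoped RealInnerProductSpace

/-! ### Surface measure on hyperplanes -/

section Hyperplane

variable {d : ℕ} {n : E d} {b : ℝ} {S : Set (E d)}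

lemma exists_affineIsometry_range_eq (hd : 1 ≤ d) (hn : ‖n‖ = 1) (b : ℝ) :
    ∃ j : E (d - 1) →ᵃⁱ[ℝ] E d, range j = {x | ⟪n, x⟫ = b} := by
  have hn0 : n ≠ 0 := by rintro rfl; simp at hn
  have : Fact (finrank ℝ (E d) = (d - 1) + 1) := ⟨by simp; omega⟩
  let u := OrthonormalBasis.fromOrthogonalSpanSingleton (𝕜 := ℝ) (d - 1) hn0
  let ι : E (d - 1) →ₗᵢ[ℝ] E d := (Submodule.subtypeₗᵢ _).comp u.repr.symm.toLinearIsometry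
  refine ⟨(AffineIsometryEquiv.constVAdd ℝ (E d) (b • n)).toAffineIsometry.comp
    ι.toAffineIsometry, Subset.antisymm ?_ fun x hx => ?_⟩
  · rintro _ ⟨y, rfl⟩
    have : ⟪n, (u.repr.symm y : E d)⟫ = 0 :=
      Submodule.mem_orthogonal_singleton_iff_inner_right.1 (u.repr.symm y).2
    simp [ι, inner_add_right, inner_smul_right, this, hn]
  · have hx' : x - b • n ∈ (ℝ ∙ n)ᗮ := by
      rw [Submodule.mem_orthogonal_singleton_iff_inner_right, inner_sub_right, inner_smul_right,
        show ⟪n, x⟫ = b from hx, real_inner_self_eq_norm_sq, hn]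
      ring
    exact ⟨u.repr ⟨_, hx'⟩, by simp [ι]⟩

lemma euclideanHausdorffMeasure_eq_volume_preimage {k : ℕ} (j : E k →ᵃⁱ[ℝ] E d)
    (hS : S ⊆ range j) : μHE[k] S = volume (j ⁻¹' S) := by
  rw [← EuclideanSpace.euclideanHausdorffMeasure_eq_volume,
    j.isometry.euclideanHausdorffMeasure_preimage, inter_eq_left.2 hS]

lemma surface_le (hd : 1 ≤ d) (hn : ‖n‖ = 1) (hS : S ⊆ {x | ⟪n, x⟫ = b})
    (hb : Bornology.IsBounded S) :
    μHE[d - 1] S ≤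
      ENNReal.ofReal (Metric.diam S ^ (d - 1)) * volume (Metric.closedBall (0 : E (d - 1)) 1) := by
  obtain ⟨j, hj⟩ := exists_affineIsometry_range_eq hd hn b
  rcases S.eq_empty_or_nonempty with rfl | ⟨x, hx⟩
  · simp
  obtain ⟨y, rfl⟩ : x ∈ range j := hj ▸ hS hx
  have hsub : j ⁻¹' S ⊆ Metric.closedBall y (Metric.diam S) := fun z hz =>
    (j.isometry.dist_eq z y).symm.trans_le (Metric.dist_le_diam_of_mem hb hz hx)
  calc μHE[d - 1] S = volume (j ⁻¹' S) :=
        euclideanHausdorffMeasure_eq_volume_preimage j (hj ▸ hS)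
    _ ≤ volume (Metric.closedBall y (Metric.diam S)) := measure_mono hsub
    _ = _ := by rw [Measure.addHaar_closedBall' _ _ Metric.diam_nonneg]; simp

lemma surface_lt_top (hd : 1 ≤ d) (hn : ‖n‖ = 1) (hS : S ⊆ {x | ⟪n, x⟫ = b})
    (hb : Bornology.IsBounded S) : μHE[d - 1] S < ⊤ :=
  (surface_le hd hn hS hb).trans_lt (ENNReal.mul_lt_top ENNReal.ofReal_lt_top
    (isCompact_closedBall _ _).measure_lt_top)

lemma surface_pos (hn : ‖n‖ = 1) (hS : S ⊆ {x | ⟪n, x⟫ = b}) (hne : S.Nonempty)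
    (hc : Convex ℝ S) (hdim : finrank ℝ (vectorSpan ℝ S) + 1 = d) : 0 < μHE[d - 1] S := by
  obtain ⟨j, hj⟩ := exists_affineIsometry_range_eq (by omega) hn b
  rw [← hj] at hS
  rw [euclideanHausdorffMeasure_eq_volume_preimage j hS]
  have himg : j.toAffineMap '' (j ⁻¹' S) = S := image_preimage_eq_of_subset hS
  have htop : vectorSpan ℝ (j ⁻¹' S) = ⊤ := by
    apply Submodule.eq_top_of_finrank_eq
    rw [← himg, ← AffineMap.map_vectorSpan, ← (Submodule.equivMapOfInjective _
      (j.toAffineMap.linear_injective_iff.2 j.injective) _).finrank_eq] at hdim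
    simp only [finrank_euclideanSpace_fin]
    omega
  have hint : (interior (j ⁻¹' S)).Nonempty :=
    (hc.affine_preimage j.toAffineMap).interior_nonempty_iff_affineSpan_eq_top.2 <|
      (AffineSubspace.affineSpan_eq_top_iff_vectorSpan_eq_top_of_nonempty ℝ _ _
        (image_nonempty.1 (himg ▸ hne))).2 htop
  exact (isOpen_interior.measure_pos volume hint).trans_le (measure_mono interior_subset)

end Hyperplane

/-! ### Cones -/

lemma integrableOn_of_isCompact {X V : Type*} [TopologicalSpace X] [T2Space X] [MeasurableSpace X]
    [OpensMeasurableSpace X] [NormedAddCommGroup V] {μ : Measure X} {S : Set X}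
    (hS : IsCompact S) (hμ : μ S < ⊤) {g : X → V} (hg : Continuous g) : IntegrableOn g S μ := by
  have : Fact (μ S < ⊤) := ⟨hμ⟩
  have h : IntegrableOn g S (μ.restrict S) := hg.continuousOn.integrableOn_compact hS
  rwa [IntegrableOn, Measure.restrict_restrict hS.measurableSet, inter_self] at h

/-- The cone with apex `x₀` over `S`, without the apex. -/
def cone {d : ℕ} (x₀ : E d) (S : Set (E d)) : Set (E d) :=
  (fun p : ℝ × E d => x₀ + p.1 • (p.2 - x₀)) '' (Ioc 0 1 ×ˢ S)

/-- The measure `D t^(d-1) dt ⊗ dS(y)` on `(0, 1] × S`. For a subset `S` of a hyperplane at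
distance `D` from `x₀`, its image under `(t, y) ↦ x₀ + t (y - x₀)` is the volume on the cone. -/
def coneMeasure {d : ℕ} (D : ℝ) (S : Set (E d)) : Measure (ℝ × E d) :=
  ((volume.restrict (Ioc (0 : ℝ) 1)).withDensity fun t => ENNReal.ofReal (D * t ^ (d - 1))).prod
    (μHE[d - 1].restrict S)

lemma cone_subset_of_convex {d : ℕ} {K S : Set (E d)} (hK : Convex ℝ K) {x₀ : E d} (hx₀ : x₀ ∈ K)
    (hS : S ⊆ K) : cone x₀ S ⊆ K := by
  rintro _ ⟨⟨t, y⟩, ⟨ht, hy⟩, rfl⟩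
  exact hK.add_smul_sub_mem hx₀ (hS hy) ⟨ht.1.le, ht.2⟩

/-- `S` is a compact subset of the hyperplane `⟪n, x⟫ = b`, and `x₀` lies strictly below this
hyperplane, so that it can serve as the apex of a cone over `S`. -/
structure ConeBase {d : ℕ} (x₀ : E d) (S : Set (E d)) (n : E d) (b : ℝ) : Prop where
  pos_dim : 1 ≤ d
  norm_eq : ‖n‖ = 1
  apex_lt : ⟪n, x₀⟫ < b
  subset : S ⊆ {x | ⟪n, x⟫ = b}
  compact : IsCompact S

namespace ConeBase

variable {d : ℕ} {x₀ : E d} {S : Set (E d)} {n : E d} {b : ℝ}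

lemma height_pos (h : ConeBase x₀ S n b) : 0 < b - ⟪n, x₀⟫ := sub_pos.2 h.apex_lt

lemma surface_lt_top (h : ConeBase x₀ S n b) : μHE[d - 1] S < ⊤ :=
  DGOldroyd.surface_lt_top h.pos_dim h.norm_eq h.subset h.compact.isBounded

lemma isFiniteMeasure_restrict (h : ConeBase x₀ S n b) :
    IsFiniteMeasure (μHE[d - 1].restrict S) :=
  MeasureTheory.isFiniteMeasure_restrict.2 h.surface_lt_top.ne

lemma integrableOn (h : ConeBase x₀ S n b) {V : Type*} [NormedAddCommGroup V] {g : E d → V}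
    (hg : Continuous g) : IntegrableOn g S μHE[d - 1] :=
  integrableOn_of_isCompact h.compact h.surface_lt_top hg

lemma inner_ray (h : ConeBase x₀ S n b) (t : ℝ) {y : E d} (hy : y ∈ S) :
    ⟪n, x₀ + t • (y - x₀)⟫ - ⟪n, x₀⟫ = t * (b - ⟪n, x₀⟫) := by
  rw [inner_add_right, inner_smul_right, inner_sub_right,
    show ⟪n, y⟫ = b from h.subset hy]
  ring

lemma injOn_ray (h : ConeBase x₀ S n b) :
    InjOn (fun p : ℝ × E d => x₀ + p.1 • (p.2 - x₀)) (Ioc 0 1 ×ˢ S) := by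
  rintro ⟨t, y⟩ ⟨ht, hy⟩ ⟨s, z⟩ ⟨-, hz⟩ (heq : x₀ + t • (y - x₀) = x₀ + s • (z - x₀))
  obtain rfl : t = s := mul_right_cancel₀ h.height_pos.ne' <| by
    rw [← h.inner_ray t hy, ← h.inner_ray s hz, heq]
  simpa [ht.1.ne'] using heq

lemma measurableSet_cone (h : ConeBase x₀ S n b) : MeasurableSet (cone x₀ S) :=
  (measurableSet_Ioc.prod h.compact.measurableSet).image_of_continuousOn_injOn
    (Continuous.continuousOn (by fun_prop)) h.injOn_ray

lemma mem_slice_iff (h : ConeBase x₀ S n b) (t : ℝ) (x : E d) :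
    x ∈ AffineSubspace.mk' (t • ((b - ⟪n, x₀⟫) • n) +ᵥ x₀) (ℝ ∙ ((b - ⟪n, x₀⟫) • n))ᗮ ↔
      ⟪n, x⟫ - ⟪n, x₀⟫ = t * (b - ⟪n, x₀⟫) := by
  rw [AffineSubspace.mem_mk', Submodule.mem_orthogonal_singleton_iff_inner_right,
    real_inner_smul_left, mul_eq_zero, or_iff_right h.height_pos.ne', vsub_eq_sub, vadd_eq_add,
    inner_sub_right, inner_add_right, real_inner_smul_right, real_inner_smul_right,
    real_inner_self_eq_norm_sq, h.norm_eq]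
  constructor <;> intro <;> linarith

lemma inter_cone_inter_slice (h : ConeBase x₀ S n b) (A : Set (E d)) (t : ℝ) :
    A ∩ cone x₀ S ∩
        AffineSubspace.mk' (t • ((b - ⟪n, x₀⟫) • n) +ᵥ x₀) (ℝ ∙ ((b - ⟪n, x₀⟫) • n))ᗮ =
      if t ∈ Ioc (0 : ℝ) 1 then
        AffineMap.homothety x₀ t '' ((fun y => x₀ + t • (y - x₀)) ⁻¹' A ∩ S)
      else ∅ := by
  have hhom : ∀ y, AffineMap.homothety x₀ t y = x₀ + t • (y - x₀) := fun y => by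
    simp [AffineMap.homothety_apply, add_comm]
  ext x
  simp only [mem_inter_iff, SetLike.mem_coe, h.mem_slice_iff]
  constructor
  · rintro ⟨⟨hA, ⟨s, y⟩, ⟨hs, hy⟩, rfl⟩, hst⟩
    rw [h.inner_ray s hy] at hst
    obtain rfl := mul_right_cancel₀ h.height_pos.ne' hst
    rw [if_pos hs]
    exact ⟨y, ⟨hA, hy⟩, hhom y⟩
  · intro hx
    split_ifs at hx with ht
    · obtain ⟨y, ⟨hA, hy⟩, rfl⟩ := hx
      rw [hhom]
      exact ⟨⟨hA, (t, y), ⟨ht, hy⟩, rfl⟩, h.inner_ray t hy⟩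
    · exact hx.elim

lemma volume_inter_cone (h : ConeBase x₀ S n b) {A : Set (E d)} (hA : MeasurableSet A) :
    volume (A ∩ cone x₀ S) = ∫⁻ t in Ioc (0 : ℝ) 1, ENNReal.ofReal ((b - ⟪n, x₀⟫) * t ^ (d - 1)) *
      μHE[d - 1] ((fun y => x₀ + t • (y - x₀)) ⁻¹' A ∩ S) := by
  have hD := h.height_pos
  have hnorm : ‖(b - ⟪n, x₀⟫) • n‖ₑ = ENNReal.ofReal (b - ⟪n, x₀⟫) := by
    rw [← ofReal_norm, norm_smul, h.norm_eq, mul_one, Real.norm_of_nonneg hD.le]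
  have hv : (b - ⟪n, x₀⟫) • n ≠ 0 := by
    rw [← enorm_ne_zero, hnorm]; simpa using hD
  rw [← InnerProductSpace.euclideanHausdorffMeasure_eq_volume,
    EuclideanGeometry.euclideanHausdorffMeasure_eq_lintegral x₀ hv
      (hA.inter h.measurableSet_cone), hnorm, ← lintegral_const_mul' _ _ ENNReal.ofReal_ne_top,
    ← lintegral_indicator measurableSet_Ioc]
  congr 1 with t
  rw [h.inter_cone_inter_slice, finrank_euclideanSpace_fin]
  split_ifs with ht
  · have ht' : ((‖t‖₊ : NNReal) : ENNReal) = ENNReal.ofReal t := Real.enorm_of_nonneg ht.1.le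
    rw [indicator_of_mem ht, euclideanHausdorffMeasure_homothety_image _ _ ht.1.ne',
      ENNReal.smul_def, smul_eq_mul, ENNReal.coe_pow, ht', ENNReal.ofReal_mul hD.le,
      ENNReal.ofReal_pow ht.1.le, mul_assoc]
  · rw [indicator_of_notMem ht, measure_empty, mul_zero]

lemma measurePreserving_ray (h : ConeBase x₀ S n b) :
    MeasurePreserving (fun p : ℝ × E d => x₀ + p.1 • (p.2 - x₀))
      (coneMeasure (b - ⟪n, x₀⟫) S) (volume.restrict (cone x₀ S)) := by
  have hm : Measurable fun p : ℝ × E d => x₀ + p.1 • (p.2 - x₀) := by fun_prop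
  have := h.isFiniteMeasure_restrict
  refine ⟨hm, ?_⟩
  ext A hA
  rw [Measure.restrict_apply hA, Measure.map_apply hm hA, coneMeasure,
    Measure.prod_apply (hA.preimage hm),
    lintegral_withDensity_eq_lintegral_mul₀ (by fun_prop)
      (measurable_measure_prodMk_left (hA.preimage hm)).aemeasurable, h.volume_inter_cone hA]
  refine lintegral_congr fun t => ?_
  rw [Pi.mul_apply, Measure.restrict_apply (by measurability)]
  rfl

lemma integrableOn_cone (h : ConeBase x₀ S n b) {G : E d → ℝ} (hG : Continuous G) :
    IntegrableOn G (cone x₀ S) :=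
  have hc : IsCompact ((fun p : ℝ × E d => x₀ + p.1 • (p.2 - x₀)) '' (Icc (0 : ℝ) 1 ×ˢ S)) :=
    (isCompact_Icc.prod h.compact).image (by fun_prop)
  (hG.continuousOn.integrableOn_compact hc).mono_set
    (image_mono (prod_mono_left Ioc_subset_Icc_self))

lemma integrable_comp_ray (h : ConeBase x₀ S n b) {G : E d → ℝ} (hG : Continuous G) :
    Integrable (fun p : ℝ × E d => G (x₀ + p.1 • (p.2 - x₀))) (coneMeasure (b - ⟪n, x₀⟫) S) :=
  (h.measurePreserving_ray.integrable_comp hG.aestronglyMeasurable).2 (h.integrableOn_cone hG)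

lemma integral_withDensity_Ioc (h : ConeBase x₀ S n b) (f : ℝ → ℝ) :
    ∫ t, f t ∂((volume.restrict (Ioc (0 : ℝ) 1)).withDensity
      fun t => ENNReal.ofReal ((b - ⟪n, x₀⟫) * t ^ (d - 1))) =
      (b - ⟪n, x₀⟫) * ∫ t in (0 : ℝ)..1, t ^ (d - 1) * f t := by
  rw [integral_withDensity_eq_integral_toReal_smul (by fun_prop) (by simp),
    intervalIntegral.integral_of_le zero_le_one, ← integral_const_mul]
  refine setIntegral_congr_fun measurableSet_Ioc fun t ht => ?_
  have : 0 ≤ (b - ⟪n, x₀⟫) * t ^ (d - 1) := mul_nonneg h.height_pos.le (pow_nonneg ht.1.le _)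
  simp [ENNReal.toReal_ofReal this, mul_assoc]

lemma setIntegral_cone (h : ConeBase x₀ S n b) {G : E d → ℝ} (hG : Continuous G) :
    ∫ x in cone x₀ S, G x = (b - ⟪n, x₀⟫) *
      surfInt S (fun y => ∫ t in (0 : ℝ)..1, t ^ (d - 1) * G (x₀ + t • (y - x₀))) := by
  have := h.isFiniteMeasure_restrict
  rw [← h.measurePreserving_ray.map_eq, integral_map (by fun_prop) hG.aestronglyMeasurable,
    coneMeasure, integral_prod_symm _ (h.integrable_comp_ray hG), surfInt, ← integral_const_mul]
  exact integral_congr_ae (ae_of_all _ fun y => h.integral_withDensity_Ioc fun t =>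
    G (x₀ + t • (y - x₀)))

lemma integrableOn_integral_ray (h : ConeBase x₀ S n b) {G : E d → ℝ} (hG : Continuous G) :
    IntegrableOn (fun y => ∫ t in (0 : ℝ)..1, t ^ (d - 1) * G (x₀ + t • (y - x₀))) S
      μHE[d - 1] := by
  have := h.isFiniteMeasure_restrict
  have hi := (h.integrable_comp_ray hG).integral_prod_right
  simp only [fun y => h.integral_withDensity_Ioc fun t => G (x₀ + t • (y - x₀))] at hi
  exact (integrable_const_mul_iff (isUnit_iff_ne_zero.2 h.height_pos.ne') _).1 hi

end ConeBase

/-! ### Polytopes -/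

section Polytope

variable {d : ℕ} {K S S' : Set (E d)} {x₀ x y n n' : E d} {b b' : ℝ}

lemma IsConvexPolytope.isClosed (hK : IsConvexPolytope K) : IsClosed K := by
  obtain ⟨-, T, rfl⟩ := hK
  simp only [ofPred_forall]
  exact isClosed_iInter fun s => isClosed_iInter fun _ =>
    isClosed_le (by fun_prop) continuous_const

lemma IsConvexPolytope.isCompact (hK : IsConvexPolytope K) : IsCompact K :=
  Metric.isCompact_of_isClosed_isBounded hK.isClosed hK.1

lemma IsConvexPolytope.convex (hK : IsConvexPolytope K) : Convex ℝ K := by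
  obtain ⟨-, T, rfl⟩ := hK
  simp only [ofPred_forall]
  exact convex_iInter fun s => convex_iInter fun _ =>
    convex_halfSpace_le (innerSL ℝ s.1).toLinearMap.isLinear _

lemma inner_add_le_of_closedBall_subset (hn : ‖n‖ = 1) {r : ℝ} (hr : 0 ≤ r)
    (hball : Metric.closedBall x₀ r ⊆ K) (hb : ∀ x ∈ K, ⟪n, x⟫ ≤ b) : ⟪n, x₀⟫ + r ≤ b := by
  have : x₀ + r • n ∈ K := hball (by simp [norm_smul, hn, abs_of_nonneg hr])
  simpa [inner_add_right, inner_smul_right, hn] using hb _ this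

lemma inner_lt_of_mem_interior (hn : ‖n‖ = 1) (hx₀ : x₀ ∈ interior K)
    (hb : ∀ x ∈ K, ⟪n, x⟫ ≤ b) : ⟪n, x₀⟫ < b := by
  obtain ⟨r, hr, hball⟩ := Metric.nhds_basis_closedBall.mem_iff.1 (mem_interior_iff_mem_nhds.1 hx₀)
  linarith [inner_add_le_of_closedBall_subset hn hr.le hball hb]

lemma exists_active_of_notMem_interior {T : Finset (E d × ℝ)}
    (hy : ∀ s ∈ T, ⟪s.1, y⟫ ≤ s.2) (hyi : y ∉ interior {x | ∀ s ∈ T, ⟪s.1, x⟫ ≤ s.2}) :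
    ∃ s ∈ T, s.1 ≠ 0 ∧ ⟪s.1, y⟫ = s.2 := by
  by_contra! hcon
  refine hyi (mem_interior_iff_mem_nhds.2 ((Filter.eventually_all_finset T).2 fun s hs => ?_))
  by_cases hs0 : s.1 = 0
  · simpa [hs0] using hy s hs
  · have hlt : ⟪s.1, y⟫ < s.2 := (hy s hs).lt_of_ne (hcon s hs hs0)
    have hc : Continuous fun x => ⟪s.1, x⟫ := by fun_prop
    exact (hc.continuousAt.eventually_lt_const hlt).mono fun _ => le_of_lt

lemma exists_ray_mem_frontier (hK : Bornology.IsBounded K) (hx : x ∈ K) (hne : x ≠ x₀) :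
    ∃ t : ℝ, 1 ≤ t ∧ x₀ + t • (x - x₀) ∈ frontier K := by
  have hout : ∃ t : ℝ, 1 ≤ t ∧ x₀ + t • (x - x₀) ∉ K := by
    obtain ⟨R, hR⟩ := hK.subset_closedBall x₀
    have htend := Filter.tendsto_id.atTop_mul_const (norm_pos_iff.2 (sub_ne_zero.2 hne))
    obtain ⟨t, hRt, ht⟩ :=
      ((htend.eventually_gt_atTop R).and (Filter.eventually_ge_atTop (1 : ℝ))).exists
    refine ⟨t, ht, fun hmem => ?_⟩
    have hle := hR hmem
    rw [mem_closedBall_iff_norm, add_sub_cancel_left, norm_smul,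
      Real.norm_of_nonneg (zero_le_one.trans ht)] at hle
    exact hle.not_gt hRt
  obtain ⟨s, hs, hsK⟩ := hout
  have : PreconnectedSpace (Ici (1 : ℝ)) := Subtype.preconnectedSpace isPreconnected_Ici
  let ray : Ici (1 : ℝ) → E d := fun t => x₀ + (t : ℝ) • (x - x₀)
  obtain ⟨t, ht⟩ : (frontier (ray ⁻¹' K)).Nonempty := nonempty_frontier_iff.2
    ⟨⟨⟨1, self_mem_Ici⟩, by simpa [ray] using hx⟩, fun h => hsK (h.ge (mem_univ ⟨s, hs⟩))⟩
  have hray : Continuous ray := by fun_prop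
  exact ⟨t, t.2, hray.frontier_preimage_subset K ht⟩

lemma exists_active_mem_cone {T : Finset (E d × ℝ)} (hK : IsConvexPolytope K)
    (hT : K = {x | ∀ s ∈ T, ⟪s.1, x⟫ ≤ s.2}) (hx : x ∈ K) (hne : x ≠ x₀) :
    ∃ s ∈ T, s.1 ≠ 0 ∧ x ∈ cone x₀ {y ∈ K | ⟪s.1, y⟫ = s.2} := by
  obtain ⟨t, ht, hmem⟩ := exists_ray_mem_frontier hK.1 hx hne
  have ht0 : 0 < t := zero_lt_one.trans_le ht
  rw [hK.isClosed.frontier_eq] at hmem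
  obtain ⟨s, hs, hs0, hact⟩ := exists_active_of_notMem_interior (hT ▸ hmem.1) (hT ▸ hmem.2)
  refine ⟨s, hs, hs0, (t⁻¹, x₀ + t • (x - x₀)),
    ⟨⟨inv_pos.2 ht0, inv_le_one_of_one_le₀ ht⟩, hmem.1, hact⟩, ?_⟩
  simp [smul_smul, ht0.ne']

lemma volume_cone_eq_zero (x₀ : E d) (hdim : finrank ℝ (vectorSpan ℝ S) + 1 < d) :
    volume (cone x₀ S) = 0 := by
  have hsub : cone x₀ S ⊆ affineSpan ℝ (insert x₀ S) := by
    rintro _ ⟨⟨t, y⟩, ⟨-, hy⟩, rfl⟩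
    have h := AffineMap.lineMap_mem t (subset_affineSpan ℝ _ (mem_insert x₀ S))
      (subset_affineSpan ℝ _ (mem_insert_of_mem x₀ hy))
    simpa [AffineMap.lineMap_apply, add_comm] using h
  refine measure_mono_null hsub (Measure.addHaar_affineSubspace _ _ fun htop => ?_)
  have hle := finrank_vectorSpan_insert_le_set ℝ S x₀
  rw [← direction_affineSpan, htop, AffineSubspace.direction_top, finrank_top,
    finrank_euclideanSpace_fin] at hle
  omega

lemma volume_hyperplane {a : E d} (ha : a ≠ 0) (x₀ : E d) :
    volume {x : E d | ⟪a, x - x₀⟫ = 0} = 0 := by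
  have : {x : E d | ⟪a, x - x₀⟫ = 0} = AffineSubspace.mk' x₀ (ℝ ∙ a)ᗮ := by
    ext x
    simp [AffineSubspace.mem_mk', Submodule.mem_orthogonal_singleton_iff_inner_right]
  rw [this]
  refine Measure.addHaar_affineSubspace _ _ fun htop => ?_
  have h := congrArg AffineSubspace.direction htop
  rw [AffineSubspace.direction_mk', AffineSubspace.direction_top,
    Submodule.orthogonal_eq_top_iff, Submodule.span_singleton_eq_bot] at h
  exact ha h

lemma finrank_vectorSpan_lt_of_inner_eq {a : E d} (ha : a ≠ 0) {c : ℝ}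
    (hS : ∀ x ∈ S, ⟪a, x⟫ = c) : finrank ℝ (vectorSpan ℝ S) < d := by
  have hle : vectorSpan ℝ S ≤ (ℝ ∙ a)ᗮ := by
    rw [vectorSpan_def, Submodule.span_le]
    rintro _ ⟨x, hx, y, hy, rfl⟩
    rw [SetLike.mem_coe, Submodule.mem_orthogonal_singleton_iff_inner_right]
    simp [inner_sub_right, hS x hx, hS y hy]
  refine (Submodule.finrank_mono hle).trans_lt ?_
  have hsum := Submodule.finrank_add_finrank_orthogonal (ℝ ∙ a)
  rw [finrank_span_singleton ha, finrank_euclideanSpace_fin] at hsum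
  omega

lemma isFacet_or_finrank_lt {a : E d} (ha : a ≠ 0) {c : ℝ} (hc : ∀ x ∈ K, ⟪a, x⟫ ≤ c) :
    IsFacet K {x ∈ K | ⟪a, x⟫ = c} (‖a‖⁻¹ • a) ∨
      finrank ℝ (vectorSpan ℝ {x ∈ K | ⟪a, x⟫ = c}) + 1 < d := by
  have ha' : 0 < ‖a‖⁻¹ := inv_pos.2 (norm_pos_iff.2 ha)
  have hlt := finrank_vectorSpan_lt_of_inner_eq ha fun x (hx : x ∈ {x ∈ K | ⟪a, x⟫ = c}) => hx.2
  refine (Nat.succ_le_of_lt hlt).eq_or_lt.imp_left fun hdim => ⟨norm_smul_inv_norm ha, hdim,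
    ‖a‖⁻¹ * c, fun x hx => ?_, ?_⟩
  · simpa only [real_inner_smul_left] using mul_le_mul_of_nonneg_left (hc x hx) ha'.le
  · simp only [real_inner_smul_left, mul_right_inj' ha'.ne']

/-- `S` is the facet of `K` on the supporting hyperplane `⟪n, x⟫ = b`; this is `IsFacet` with an
explicit offset, which gives the distance `b - ⟪n, x₀⟫` of a point `x₀` to the facet. -/
structure IsFacetAt {d : ℕ} (K S : Set (E d)) (n : E d) (b : ℝ) : Prop where
  norm_eq : ‖n‖ = 1
  finrank_eq : finrank ℝ (vectorSpan ℝ S) + 1 = d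
  le : ∀ x ∈ K, ⟪n, x⟫ ≤ b
  eq : S = {x ∈ K | ⟪n, x⟫ = b}

lemma IsFacet.exists_isFacetAt (h : IsFacet K S n) : ∃ b, IsFacetAt K S n b :=
  let ⟨hn, hdim, b, hle, heq⟩ := h
  ⟨b, hn, hdim, hle, heq⟩

namespace IsFacetAt

lemma pos_dim (h : IsFacetAt K S n b) : 1 ≤ d := by
  have := h.finrank_eq
  omega

lemma subset (h : IsFacetAt K S n b) : S ⊆ K :=
  h.eq ▸ sep_subset _ _

lemma subset_hyperplane (h : IsFacetAt K S n b) : S ⊆ {x | ⟪n, x⟫ = b} := by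
  rw [h.eq]
  exact fun x hx => hx.2

lemma isCompact (h : IsFacetAt K S n b) (hK : IsConvexPolytope K) : IsCompact S := by
  rw [h.eq]
  exact hK.isCompact.inter_right (isClosed_eq (by fun_prop) continuous_const)

lemma convex (h : IsFacetAt K S n b) (hK : IsConvexPolytope K) : Convex ℝ S := by
  rw [h.eq]
  exact hK.convex.inter (convex_hyperplane (innerSL ℝ n).toLinearMap.isLinear _)

lemma nonempty (h : IsFacetAt K S n b) (hd : 2 ≤ d) : S.Nonempty := by
  rw [nonempty_iff_ne_empty]
  rintro rfl
  have := h.finrank_eq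
  rw [vectorSpan_empty, finrank_bot] at this
  omega

lemma apex_lt (h : IsFacetAt K S n b) (hx₀ : x₀ ∈ interior K) : ⟪n, x₀⟫ < b :=
  inner_lt_of_mem_interior h.norm_eq hx₀ h.le

lemma coneBase (h : IsFacetAt K S n b) (hK : IsConvexPolytope K) (hx₀ : x₀ ∈ interior K) :
    ConeBase x₀ S n b where
  pos_dim := h.pos_dim
  norm_eq := h.norm_eq
  apex_lt := h.apex_lt hx₀
  subset := h.subset_hyperplane
  compact := h.isCompact hK

lemma mem_iff_inner_eq_one (h : IsFacetAt K S n b) (hx₀ : ⟪n, x₀⟫ < b) :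
    y ∈ S ↔ y ∈ K ∧ ⟪(b - ⟪n, x₀⟫)⁻¹ • n, y - x₀⟫ = 1 := by
  rw [h.eq, real_inner_smul_left, inner_sub_right, inv_mul_eq_one₀ (sub_pos.2 hx₀).ne',
    sub_left_inj, eq_comm (a := b)]
  rfl

lemma le_of_smul_sub_eq (h : IsFacetAt K S n b) (hx₀ : ⟪n, x₀⟫ < b) (hx : x ∈ K) (hy : y ∈ S)
    {s t : ℝ} (hs : 0 < s) (heq : s • (x - x₀) = t • (y - x₀)) : t ≤ s := by
  have hle : ⟪n, s • (x - x₀)⟫ ≤ s * (b - ⟪n, x₀⟫) := by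
    rw [real_inner_smul_right, inner_sub_right]
    exact mul_le_mul_of_nonneg_left (by linarith [h.le x hx]) hs.le
  rw [heq, real_inner_smul_right, inner_sub_right,
    show ⟪n, y⟫ = b from h.subset_hyperplane hy] at hle
  exact le_of_mul_le_mul_right hle (sub_pos.2 hx₀)

/-- With `a i` the normal of the facet `i`, scaled such that the facet lies on
`⟪a i, x - x₀⟫ = 1`, the common points of the two cones lie on `⟪a 1 - a 2, x - x₀⟫ = 0`. -/
lemma aedisjoint_cone (h : IsFacetAt K S n b) (h' : IsFacetAt K S' n' b')
    (hx₀ : x₀ ∈ interior K) (hne : S ≠ S') : AEDisjoint volume (cone x₀ S) (cone x₀ S') := by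
  have hmem := fun y => h.mem_iff_inner_eq_one (y := y) (h.apex_lt hx₀)
  have hmem' := fun y => h'.mem_iff_inner_eq_one (y := y) (h'.apex_lt hx₀)
  set a := (b - ⟪n, x₀⟫)⁻¹ • n
  set a' := (b' - ⟪n', x₀⟫)⁻¹ • n'
  have ha : a - a' ≠ 0 := fun h0 => hne <| ext fun y => by rw [hmem, hmem', sub_eq_zero.1 h0]
  refine measure_mono_null ?_ (volume_hyperplane ha x₀)
  rintro _ ⟨⟨⟨s, y⟩, ⟨hs, hy⟩, rfl⟩, ⟨t, y'⟩, ⟨ht, hy'⟩, heq⟩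
  replace heq : t • (y' - x₀) = s • (y - x₀) := add_left_cancel heq
  obtain rfl : s = t := le_antisymm
    (h.le_of_smul_sub_eq (h.apex_lt hx₀) (h'.subset hy') hy ht.1 heq)
    (h'.le_of_smul_sub_eq (h'.apex_lt hx₀) (h.subset hy) hy' hs.1 heq.symm)
  have hyy' : y' - x₀ = y - x₀ := smul_right_injective _ ht.1.ne' heq
  have h1 : ⟪a, y - x₀⟫ = 1 := ((hmem y).1 hy).2
  have h1' : ⟪a', y - x₀⟫ = 1 := hyy' ▸ ((hmem' y').1 hy').2
  simp [inner_sub_left, real_inner_smul_right, h1, h1']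

end IsFacetAt

/-- `S` enumerates the facets of the polytope `K` without repetition; the facet `S i` lies on the
hyperplane `⟪n i, x⟫ = b i`. -/
structure FacetList {d : ℕ} (K : Set (E d)) {I : Type*} (S : I → Set (E d)) (n : I → E d)
    (b : I → ℝ) : Prop where
  polytope : IsConvexPolytope K
  isFacetAt : ∀ i, IsFacetAt K (S i) (n i) (b i)
  injective : Function.Injective S
  complete : ∀ S' n', IsFacet K S' n' → ∃ i, S i = S'

end Polytope

namespace FacetList

variable {d : ℕ} {K : Set (E d)} {I : Type*} {S : I → Set (E d)} {n : I → E d} {b : I → ℝ}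
  {x₀ : E d}

lemma coneBase (h : FacetList K S n b) (hx₀ : x₀ ∈ interior K) (i : I) :
    ConeBase x₀ (S i) (n i) (b i) :=
  (h.isFacetAt i).coneBase h.polytope hx₀

/-- The rays from `x₀` leave `K` through faces; the cones over the faces of dimension less than
`d - 1` are null sets. -/
lemma ae_eq_iUnion_cone (h : FacetList K S n b) (hx₀ : x₀ ∈ interior K) (hd : 1 ≤ d) :
    K =ᵐ[volume] ⋃ i, cone x₀ (S i) := by
  have hsub : (⋃ i, cone x₀ (S i)) ⊆ K := iUnion_subset fun i =>
    cone_subset_of_convex h.polytope.convex (interior_subset hx₀) (h.isFacetAt i).subset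
  refine Filter.EventuallyLE.antisymm (ae_le_set.2 ?_) hsub.eventuallyLE
  obtain ⟨T, hT⟩ := h.polytope.2
  let T' : Set (E d × ℝ) :=
    {s | s ∈ T ∧ finrank ℝ (vectorSpan ℝ {x ∈ K | ⟪s.1, x⟫ = s.2}) + 1 < d}
  have hnull : volume ({x₀} ∪ ⋃ s ∈ T', cone x₀ {x ∈ K | ⟪s.1, x⟫ = s.2}) = 0 := by
    have : Nonempty (Fin d) := ⟨⟨0, hd⟩⟩
    refine measure_union_null (by simp) ?_
    rw [measure_biUnion_null_iff (T.finite_toSet.subset fun s hs => hs.1).countable]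
    exact fun s hs => volume_cone_eq_zero x₀ hs.2
  refine measure_mono_null (fun x ⟨hxK, hxU⟩ => ?_) hnull
  rcases eq_or_ne x x₀ with rfl | hxx
  · exact Or.inl rfl
  obtain ⟨s, hs, hs0, hxc⟩ := exists_active_mem_cone h.polytope hT hxK hxx
  rcases isFacet_or_finrank_lt hs0 fun x hx => (hT.subset hx) s hs with hf | hlt
  · obtain ⟨i, hi⟩ := h.complete _ _ hf
    exact absurd (mem_iUnion.2 ⟨i, hi ▸ hxc⟩) hxU
  · exact Or.inr (mem_biUnion (x := s) ⟨hs, hlt⟩ hxc)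

lemma setIntegral_eq_sum_cone [Fintype I] (h : FacetList K S n b) (hx₀ : x₀ ∈ interior K)
    (hd : 1 ≤ d) {G : E d → ℝ} (hG : Continuous G) :
    ∫ x in K, G x = ∑ i, ∫ x in cone x₀ (S i), G x := by
  have hdisj : Pairwise (Function.onFun (AEDisjoint volume) fun i => cone x₀ (S i)) :=
    fun i j hij => (h.isFacetAt i).aedisjoint_cone (h.isFacetAt j) hx₀ (h.injective.ne hij)
  rw [Measure.restrict_congr_set (h.ae_eq_iUnion_cone hx₀ hd), Measure.restrict_iUnion_ae hdisj
      fun i => (h.coneBase hx₀ i).measurableSet_cone.nullMeasurableSet,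
    Measure.sum_fintype,
    integral_finsetSum_measure fun i _ => (h.coneBase hx₀ i).integrableOn_cone hG]

end FacetList

/-! ### The divergence theorem -/

lemma hasDerivAt_pow_mul_ray {d : ℕ} (hd : 1 ≤ d) {g : E d → ℝ}
    (hg : Differentiable ℝ g) (x₀ v : E d) (t : ℝ) :
    HasDerivAt (fun t : ℝ => t ^ d * g (x₀ + t • v))
      (t ^ (d - 1) * (d * g (x₀ + t • v) + fderiv ℝ g (x₀ + t • v) (t • v))) t := by
  have hray : HasDerivAt (fun t : ℝ => x₀ + t • v) v t := by
    simpa using ((hasDerivAt_id t).smul_const v).const_add x₀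
  have hpow : t ^ d = t ^ (d - 1) * t := by rw [← pow_succ, Nat.sub_add_cancel hd]
  refine ((hasDerivAt_pow d t).mul ((hg _).hasFDerivAt.comp_hasDerivAt t hray)).congr_deriv ?_
  rw [map_smul, smul_eq_mul, hpow, Function.comp_apply]
  ring

lemma ConeBase.setIntegral_radial {d : ℕ} {x₀ : E d} {S : Set (E d)} {n : E d} {b : ℝ}
    (h : ConeBase x₀ S n b) {g : E d → ℝ} (hg : ContDiff ℝ 1 g) :
    ∫ x in cone x₀ S, (d * g x + fderiv ℝ g x (x - x₀)) = (b - ⟪n, x₀⟫) * surfInt S g := by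
  have := hg.continuous_fderiv one_ne_zero
  have := hg.continuous
  rw [h.setIntegral_cone (by fun_prop)]
  congr 2 with y
  simp only [add_sub_cancel_left]
  rw [intervalIntegral.integral_eq_sub_of_hasDerivAt
    (fun t _ => hasDerivAt_pow_mul_ray h.pos_dim (hg.differentiable one_ne_zero) x₀ (y - x₀) t)
    (Continuous.intervalIntegrable (by fun_prop) _ _)]
  simp [show d ≠ 0 by linarith [h.pos_dim]]

/-- The difference of the radial identities with centres `x₀` and `x₀ + s v` is `s` times the
divergence theorem for the vector field `g v`. -/
theorem FacetList.setIntegral_fderiv {d : ℕ} {K : Set (E d)} {I : Type*} [Fintype I]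
    {S : I → Set (E d)} {n : I → E d} {b : I → ℝ} (h : FacetList K S n b)
    (hK : (interior K).Nonempty) (hd : 1 ≤ d) {g : E d → ℝ} (hg : ContDiff ℝ 1 g) (v : E d) :
    ∫ x in K, fderiv ℝ g x v = ∑ i, ⟪n i, v⟫ * surfInt (S i) g := by
  obtain ⟨x₀, hx₀⟩ := hK
  have := hg.continuous_fderiv one_ne_zero
  have := hg.continuous
  obtain ⟨s, hs, hs0⟩ : ∃ s : ℝ, x₀ + s • v ∈ interior K ∧ s ≠ 0 := by
    have hc : ContinuousAt (fun s : ℝ => x₀ + s • v) 0 := by fun_prop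
    have hev := hc.eventually_mem (isOpen_interior.mem_nhds (by simpa using hx₀))
    exact ((hev.filter_mono nhdsWithin_le_nhds).and
      (self_mem_nhdsWithin (s := {(0 : ℝ)}ᶜ))).exists
  have hint : ∀ x₁ : E d, IntegrableOn (fun x => d * g x + fderiv ℝ g x (x - x₁)) K := fun x₁ =>
    (Continuous.continuousOn (by fun_prop)).integrableOn_compact h.polytope.isCompact
  have hdiff : (fun x => s * fderiv ℝ g x v) = fun x => (d * g x + fderiv ℝ g x (x - x₀)) -
      (d * g x + fderiv ℝ g x (x - (x₀ + s • v))) := by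
    ext x
    simp only [map_sub, map_add, map_smul, smul_eq_mul]
    ring
  refine mul_left_cancel₀ hs0 ?_
  rw [← integral_const_mul, hdiff, integral_sub (hint _) (hint _),
    h.setIntegral_eq_sum_cone hx₀ hd (by fun_prop), h.setIntegral_eq_sum_cone hs hd (by fun_prop),
    ← Finset.sum_sub_distrib, Finset.mul_sum]
  refine Finset.sum_congr rfl fun i _ => ?_
  rw [(h.coneBase hx₀ i).setIntegral_radial hg, (h.coneBase hs i).setIntegral_radial hg,
    inner_add_right, real_inner_smul_right]
  ring

/-! ### Bilinear forms on finite-dimensional spaces -/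

section BilinearForm

variable {V : Type*} [AddCommGroup V] [Module ℝ V] [FiniteDimensional ℝ V]
  {B : V →ₗ[ℝ] V →ₗ[ℝ] ℝ}

lemma existsUnique_riesz (hB : ∀ v, B v v = 0 → v = 0) (l : V →ₗ[ℝ] ℝ) :
    ∃! u, ∀ v, B u v = l v := by
  have hinj : Function.Injective B :=
    (injective_iff_map_eq_zero B).2 fun v hv => hB v (by rw [hv]; rfl)
  have hbij : Function.Bijective B :=
    ⟨hinj, (LinearMap.injective_iff_surjective_of_finrank_eq_finrank
      (Subspace.dual_finrank_eq (K := ℝ) (V := V)).symm).1 hinj⟩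
  simpa only [LinearMap.ext_iff] using hbij.existsUnique l

lemma exists_sq_le_mul_self (hnn : ∀ v, 0 ≤ B v v) (hB : ∀ v, B v v = 0 → v = 0)
    (hsymm : ∀ u v, B u v = B v u) (l : V →ₗ[ℝ] ℝ) : ∃ C > 0, ∀ v, l v ^ 2 ≤ C * B v v := by
  obtain ⟨q, hq, -⟩ := existsUnique_riesz hB l
  refine ⟨B q q + 1, by linarith [hnn q], fun v => ?_⟩
  have hcs : l v ^ 2 ≤ B q q * B v v := by
    simpa only [hsymm v q, hq, ← sq] using
      LinearMap.BilinForm.apply_mul_apply_le_of_forall_zero_le B hnn q v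
  linarith [hnn v]

end BilinearForm

/-! ### Polynomials in one variable -/

section Polynomial

open Polynomial

lemma eq_zero_of_setIntegral_eq_zero {X : Type*} [TopologicalSpace X] [MeasurableSpace X]
    {μ : Measure X} [μ.IsOpenPosMeasure] {U : Set X} {f : X → ℝ}
    (hf : Continuous f) (h0 : ∀ x ∈ U, 0 ≤ f x) (hU : MeasurableSet U) (hi : IntegrableOn f U μ)
    (h : ∫ x in U, f x ∂μ = 0) {x : X} (hx : x ∈ interior U) : f x = 0 := by
  rw [setIntegral_eq_zero_iff_of_nonneg_ae ((ae_restrict_iff' hU).2 (ae_of_all _ h0)) hi] at h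
  have h' : f =ᵐ[μ.restrict (interior U)] 0 :=
    Filter.EventuallyEq.filter_mono h (ae_mono (Measure.restrict_mono interior_subset le_rfl))
  exact Measure.eqOn_open_of_ae_eq h' isOpen_interior hf.continuousOn continuousOn_const hx

/-- The functional `P ↦ ∫₀¹ t^k P(t) dt`. -/
def weightedIntegral (k : ℕ) : ℝ[X] →ₗ[ℝ] ℝ where
  toFun P := ∫ t in (0 : ℝ)..1, t ^ k * P.eval t
  map_add' P Q := by
    simp only [eval_add, mul_add]
    exact intervalIntegral.integral_add (Continuous.intervalIntegrable (by fun_prop) _ _)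
      (Continuous.intervalIntegrable (by fun_prop) _ _)
  map_smul' c P := by
    simp only [eval_smul, smul_eq_mul, mul_left_comm _ c, intervalIntegral.integral_const_mul,
      RingHom.id_apply]

lemma weightedIntegral_sq (k : ℕ) (P : ℝ[X]) :
    weightedIntegral k (P * P) = ∫ t in (0 : ℝ)..1, t ^ k * P.eval t ^ 2 := by
  simp [weightedIntegral, sq]

lemma weightedIntegral_sq_nonneg (k : ℕ) (P : ℝ[X]) : 0 ≤ weightedIntegral k (P * P) := by
  rw [weightedIntegral_sq]
  exact intervalIntegral.integral_nonneg zero_le_one fun _ ht =>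
    mul_nonneg (pow_nonneg ht.1 _) (sq_nonneg _)

lemma eq_zero_of_weightedIntegral_sq_eq_zero {k : ℕ} {P : ℝ[X]}
    (h : weightedIntegral k (P * P) = 0) : P = 0 := by
  rw [weightedIntegral_sq, intervalIntegral.integral_of_le zero_le_one] at h
  have hc : Continuous fun t : ℝ => t ^ k * P.eval t ^ 2 := by fun_prop
  refine eq_zero_of_infinite_isRoot P ((Ioo_infinite (zero_lt_one' ℝ)).mono fun t ht => ?_)
  have hprod := eq_zero_of_setIntegral_eq_zero hc
    (fun t ht => mul_nonneg (pow_nonneg ht.1.le _) (sq_nonneg _)) measurableSet_Ioc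
    ((hc.continuousOn.integrableOn_compact isCompact_Icc).mono_set Ioc_subset_Icc_self) h
    (x := t) (by rwa [interior_Ioc])
  exact pow_eq_zero_iff two_ne_zero |>.1
    ((mul_eq_zero_iff_left (pow_pos ht.1 k).ne').1 hprod)

lemma exists_eval_one_sq_le (k r : ℕ) : ∃ C > 0, ∀ P : ℝ[X], P.natDegree ≤ r →
    P.eval 1 ^ 2 ≤ C * ∫ t in (0 : ℝ)..1, t ^ k * P.eval t ^ 2 := by
  let V := degreeLT ℝ (r + 1)
  let B : V →ₗ[ℝ] V →ₗ[ℝ] ℝ :=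
    ((LinearMap.mul ℝ ℝ[X]).compr₂ (weightedIntegral k)).compl₁₂ V.subtype V.subtype
  have : FiniteDimensional ℝ V := Module.Finite.equiv (degreeLTEquiv ℝ (r + 1)).symm
  obtain ⟨C, hC, h⟩ := exists_sq_le_mul_self (B := B) (fun v => weightedIntegral_sq_nonneg k v)
    (fun v hv => Subtype.ext (eq_zero_of_weightedIntegral_sq_eq_zero hv))
    (fun u v => congrArg (weightedIntegral k) (mul_comm (u : ℝ[X]) v)) (leval 1 ∘ₗ V.subtype)
  refine ⟨C, hC, fun P hP => weightedIntegral_sq k P ▸ h ⟨P, mem_degreeLT.2 ?_⟩⟩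
  exact (degree_le_of_natDegree_le hP).trans_lt (by exact_mod_cast Nat.lt_succ_self r)

end Polynomial

/-! ### Polynomial functions on `ℝ^d` -/

section PolyFun

variable {d r : ℕ} {g : E d → ℝ}

lemma hasFDerivAt_eval (q : MvPolynomial (Fin d) ℝ) (x : E d) :
    HasFDerivAt (fun x : E d => MvPolynomial.eval (fun i => x i) q)
      (∑ i, MvPolynomial.eval (fun i => x i) (MvPolynomial.pderiv i q) •
        (EuclideanSpace.proj i : E d →L[ℝ] ℝ)) x := by
  induction q using MvPolynomial.induction_on with
  | C a => simpa using hasFDerivAt_const a x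
  | add p q hp hq =>
    simp only [map_add, add_smul, Finset.sum_add_distrib]
    exact hp.add hq
  | mul_X p j hp =>
    have h := hp.mul ((EuclideanSpace.proj j : E d →L[ℝ] ℝ).hasFDerivAt (x := x))
    simp only [map_mul, MvPolynomial.eval_X]
    refine h.congr_fderiv ?_
    simp only [Derivation.leibniz, MvPolynomial.pderiv_X, map_add, smul_eq_mul, map_mul,
      MvPolynomial.eval_X, add_smul, Finset.sum_add_distrib, mul_smul, Finset.smul_sum]
    congr 1
    rw [Finset.sum_eq_single j (fun i _ hij => by simp [hij]) (by simp)]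
    simp

lemma totalDegree_pderiv_le (i : Fin d) (q : MvPolynomial (Fin d) ℝ) :
    (MvPolynomial.pderiv i q).totalDegree ≤ q.totalDegree := by
  conv_lhs => rw [q.as_sum, map_sum]
  refine MvPolynomial.totalDegree_finsetSum_le fun s hs => ?_
  rw [MvPolynomial.pderiv_monomial]
  exact (MvPolynomial.totalDegree_monomial_le _ _).trans
    ((Finsupp.degree_mono tsub_le_self).trans (MvPolynomial.le_totalDegree hs))

lemma contDiff_of_mem_polyFun (hg : g ∈ polyFun d r) {k : WithTop ℕ∞} : ContDiff ℝ k g := by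
  obtain ⟨q, -, hq⟩ := hg
  rw [funext hq]
  clear hq
  induction q using MvPolynomial.induction_on with
  | C a => simpa using contDiff_const
  | add p q hp hq => simpa only [map_add] using hp.add hq
  | mul_X p j hp =>
    simp only [map_mul, MvPolynomial.eval_X]
    exact hp.mul (EuclideanSpace.proj j : E d →L[ℝ] ℝ).contDiff

lemma fderiv_apply_mem_polyFun (hg : g ∈ polyFun d r) (v : E d) :
    (fun x => fderiv ℝ g x v) ∈ polyFun d r := by
  obtain ⟨q, hqd, hq⟩ := hg
  have hfderiv : (fun x => fderiv ℝ g x v) =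
      ∑ i, v i • fun x => MvPolynomial.eval (fun i => x i) (MvPolynomial.pderiv i q) := by
    ext x
    rw [funext hq, (hasFDerivAt_eval q x).fderiv]
    simp [mul_comm]
  rw [hfderiv]
  exact Submodule.sum_mem _ fun i _ => Submodule.smul_mem _ _
    ⟨_, (totalDegree_pderiv_le i q).trans hqd, fun x => rfl⟩

lemma exists_polynomial_eq_comp_ray (hg : g ∈ polyFun d r) (x₀ v : E d) :
    ∃ P : Polynomial ℝ, P.natDegree ≤ r ∧ ∀ t, g (x₀ + t • v) = P.eval t := by
  obtain ⟨q, hqd, hq⟩ := hg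
  let p : Fin d → Polynomial ℝ := fun i => .C (x₀ i) + .C (v i) * .X
  refine ⟨MvPolynomial.aeval p q, ?_, fun t => ?_⟩
  · simpa using MvPolynomial.aeval_natDegree_le q hqd p (n := 1) fun i => by
      simp only [p]; compute_degree
  · have hp : (fun i => (x₀ + t • v) i) = fun i => Polynomial.aeval t (p i) := by
      ext i
      simp only [p, PiLp.add_apply, PiLp.smul_apply, smul_eq_mul, map_add, map_mul,
        Polynomial.aeval_C, Polynomial.aeval_X, Algebra.algebraMap_self, RingHom.id_apply]
      ring
    rw [hq, ← Polynomial.coe_aeval_eq_eval, ← AlgHom.comp_apply, MvPolynomial.comp_aeval,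
      MvPolynomial.aeval_eq_eval, hp]

lemma eq_zero_of_mem_polyFun (hg : g ∈ polyFun d r) {U : Set (E d)}
    (hU : (interior U).Nonempty) (h : ∀ x ∈ interior U, g x = 0) : g = 0 := by
  obtain ⟨x₀, hx₀⟩ := hU
  ext x
  obtain ⟨P, -, hP⟩ := exists_polynomial_eq_comp_ray hg x₀ (x - x₀)
  have hev : ∀ᶠ t in nhds (0 : ℝ), x₀ + t • (x - x₀) ∈ interior U := by
    have hc : ContinuousAt (fun s : ℝ => x₀ + s • (x - x₀)) 0 := by fun_prop
    exact hc.eventually_mem (isOpen_interior.mem_nhds (by simpa using hx₀))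
  have hP0 : P = 0 := Polynomial.eq_zero_of_infinite_isRoot P <|
    (infinite_of_mem_nhds (0 : ℝ) hev).mono fun t ht => (hP t).symm.trans (h _ ht)
  simpa [hP0] using hP 1

instance finiteDimensional_polyFun : FiniteDimensional ℝ (polyFun d r) := by
  let evalLin : MvPolynomial (Fin d) ℝ →ₗ[ℝ] (E d → ℝ) :=
    { toFun := fun q x => MvPolynomial.eval (fun i => x i) q
      map_add' := fun _ _ => by ext; simp
      map_smul' := fun _ _ => by ext; simp }
  have : polyFun d r = (MvPolynomial.restrictTotalDegree (Fin d) ℝ r).map evalLin := by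
    ext g
    constructor
    · rintro ⟨q, hq, h⟩
      exact ⟨q, (MvPolynomial.mem_restrictTotalDegree _ _ _).2 hq, (funext h).symm⟩
    · rintro ⟨q, hq, rfl⟩
      exact ⟨q, (MvPolynomial.mem_restrictTotalDegree _ _ _).1 hq, fun x => rfl⟩
  rw [this]
  infer_instance

end PolyFun

/-! ### The discrete trace inequality on a polytope -/

lemma ConeBase.mul_surfInt_sq_le {d r : ℕ} {x₀ : E d} {S : Set (E d)} {n : E d} {b : ℝ}
    (h : ConeBase x₀ S n b) {C : ℝ}
    (hC : ∀ P : Polynomial ℝ, P.natDegree ≤ r →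
      P.eval 1 ^ 2 ≤ C * ∫ t in (0 : ℝ)..1, t ^ (d - 1) * P.eval t ^ 2)
    {g : E d → ℝ} (hg : g ∈ polyFun d r) :
    (b - ⟪n, x₀⟫) * surfInt S (fun x => g x ^ 2) ≤ C * ∫ x in cone x₀ S, g x ^ 2 := by
  have hg2 : Continuous fun x => g x ^ 2 := (contDiff_of_mem_polyFun hg (k := 0)).continuous.pow 2
  rw [h.setIntegral_cone hg2, mul_left_comm]
  refine mul_le_mul_of_nonneg_left ?_ h.height_pos.le
  rw [surfInt, surfInt, ← integral_const_mul]
  refine setIntegral_mono (h.integrableOn hg2) ((h.integrableOn_integral_ray hg2).const_mul C)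
    fun y => ?_
  obtain ⟨P, hPr, hP⟩ := exists_polynomial_eq_comp_ray hg x₀ (y - x₀)
  have hy : g y = P.eval 1 := by simpa using hP 1
  simpa only [hy, hP] using hC P hPr

lemma FacetList.mul_sum_surfInt_sq_le {d r : ℕ} {K : Set (E d)} {I : Type*} [Fintype I]
    {S : I → Set (E d)} {n : I → E d} {b : I → ℝ} (h : FacetList K S n b) (hd : 1 ≤ d) {C : ℝ}
    (hC : ∀ P : Polynomial ℝ, P.natDegree ≤ r →
      P.eval 1 ^ 2 ≤ C * ∫ t in (0 : ℝ)..1, t ^ (d - 1) * P.eval t ^ 2)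
    {x₀ : E d} {δ : ℝ} (hδ : 0 < δ) (hball : Metric.closedBall x₀ δ ⊆ K) {g : E d → ℝ}
    (hg : g ∈ polyFun d r) :
    δ * ∑ i, surfInt (S i) (fun x => g x ^ 2) ≤ C * ∫ x in K, g x ^ 2 := by
  have hg2 : Continuous fun x => g x ^ 2 := (contDiff_of_mem_polyFun hg (k := 0)).continuous.pow 2
  have hx₀ : x₀ ∈ interior K :=
    mem_interior_iff_mem_nhds.2 (Filter.mem_of_superset (Metric.closedBall_mem_nhds x₀ hδ) hball)
  rw [h.setIntegral_eq_sum_cone hx₀ hd hg2, Finset.mul_sum, Finset.mul_sum]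
  refine Finset.sum_le_sum fun i _ => le_trans ?_ ((h.coneBase hx₀ i).mul_surfInt_sq_le hC hg)
  have hi := h.isFacetAt i
  refine mul_le_mul_of_nonneg_right ?_ (integral_nonneg fun x => sq_nonneg _)
  linarith [inner_add_le_of_closedBall_subset hi.norm_eq hδ.le hball hi.le]

namespace Mesh

section Geometry

variable {d : ℕ} {O : Set (E d)} (m : Mesh O)

/-! ### Cells and faces -/

lemma isCompact_cell (K : m.Cell) : IsCompact (m.cell K) := (m.cell_polytope K).isCompact

lemma integrableOn_cell (K : m.Cell) {V : Type*} [NormedAddCommGroup V] {g : E d → V}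
    (hg : Continuous g) : IntegrableOn g (m.cell K) :=
  hg.continuousOn.integrableOn_compact (m.isCompact_cell K)

lemma exists_isFacetAt (F : m.Face) :
    ∃ b, IsFacetAt (m.cell (m.fst F)) (m.face F) (m.normal F) b :=
  (m.fst_facet F).exists_isFacetAt

lemma isCompact_face (F : m.Face) : IsCompact (m.face F) :=
  let ⟨_, h⟩ := m.exists_isFacetAt F
  h.isCompact (m.cell_polytope _)

lemma surface_face_lt_top (F : m.Face) : μHE[d - 1] (m.face F) < ⊤ :=
  let ⟨_, h⟩ := m.exists_isFacetAt F
  surface_lt_top h.pos_dim h.norm_eq h.subset_hyperplane (m.isCompact_face F).isBounded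

lemma surface_face_pos (hd : 2 ≤ d) (F : m.Face) : 0 < μHE[d - 1] (m.face F) :=
  let ⟨_, h⟩ := m.exists_isFacetAt F
  surface_pos h.norm_eq h.subset_hyperplane (h.nonempty hd) (h.convex (m.cell_polytope _))
    h.finrank_eq

lemma integrableOn_face (F : m.Face) {V : Type*} [NormedAddCommGroup V] {g : E d → V}
    (hg : Continuous g) : IntegrableOn g (m.face F) μHE[d - 1] :=
  integrableOn_of_isCompact (m.isCompact_face F) (m.surface_face_lt_top F) hg

lemma hF_pos (hd : 2 ≤ d) (F : m.Face) : 0 < m.hF F :=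
  Real.rpow_pos_of_pos
    (ENNReal.toReal_pos (m.surface_face_pos hd F).ne' (m.surface_face_lt_top F).ne) _

lemma snd_ne_fst (hd : 2 ≤ d) (F : m.Face) : m.snd F ≠ some (m.fst F) := by
  intro hF
  obtain ⟨b, h⟩ := m.exists_isFacetAt F
  obtain ⟨b', h'⟩ := (m.snd_facet F _ hF).exists_isFacetAt
  obtain ⟨y, hy⟩ := h.nonempty hd
  obtain ⟨x, hx⟩ := m.cell_interior (m.fst F)
  have hb : ⟪m.normal F, y⟫ = b := h.subset_hyperplane hy
  have hb' : ⟪-m.normal F, y⟫ = b' := h'.subset_hyperplane hy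
  have hlt := h.apex_lt hx
  have hlt' := h'.apex_lt hx
  rw [inner_neg_left] at hb' hlt'
  linarith

/-- The outward normal of the cell `K` on `F`, provided that `F` is a face of `K`. -/
def outNormal (K : m.Cell) (F : m.Face) : E d :=
  open Classical in if m.fst F = K then m.normal F else -m.normal F

lemma isFacet_outNormal (K : m.Cell) {F : m.Face} (hF : m.fst F = K ∨ m.snd F = some K) :
    IsFacet (m.cell K) (m.face F) (m.outNormal K F) := by
  unfold outNormal
  split_ifs with h
  · exact h ▸ m.fst_facet F
  · exact m.snd_facet F K (hF.resolve_left h)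

/-- The faces of the cell `K`. -/
abbrev FaceOf (K : m.Cell) := {F // m.fst F = K ∨ m.snd F = some K}

instance (K : m.Cell) : Fintype (m.FaceOf K) := Fintype.ofFinite _

lemma exists_facetList (K : m.Cell) : ∃ b : m.FaceOf K → ℝ,
    FacetList (m.cell K) (fun F : m.FaceOf K => m.face F) (fun F => m.outNormal K F) b := by
  choose b hb using fun F : m.FaceOf K => (m.isFacet_outNormal K F.2).exists_isFacetAt
  exact ⟨b, m.cell_polytope K, hb, fun F G h => Subtype.ext (m.face_injective h),
    fun S n h => let ⟨F, hF, hK⟩ := m.facet_mem K S n h; ⟨⟨F, hK⟩, hF⟩⟩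

lemma sum_cells_faces (hd : 2 ≤ d) (φ : m.Cell → m.Face → ℝ) :
    ∑ K, ∑ F : m.FaceOf K, φ K F =
      ∑ F, (φ (m.fst F) F + (m.snd F).elim 0 fun K => φ K F) := by
  classical
  have hsplit : ∀ K, ∑ F : m.FaceOf K, φ K F =
      ∑ F, ((if m.fst F = K then φ K F else 0) + if m.snd F = some K then φ K F else 0) := by
    intro K
    rw [← Finset.sum_subtype (Finset.univ.filter fun F => m.fst F = K ∨ m.snd F = some K)
      (by simp) (φ K), Finset.sum_filter]
    refine Finset.sum_congr rfl fun F _ => ?_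
    have hne := m.snd_ne_fst hd F
    grind
  simp_rw [hsplit]
  rw [Finset.sum_comm]
  refine Finset.sum_congr rfl fun F _ => ?_
  rw [Finset.sum_add_distrib]
  cases m.snd F <;> simp

section Traces

variable {V : Type*} [NormedAddCommGroup V] {w : m.Cell → E d → V}

lemma continuous_outer (hw : ∀ K, Continuous (w K)) (F : m.Face) : Continuous (m.outer w F) := by
  unfold outer
  cases m.snd F with
  | none => exact continuous_const
  | some K => exact hw K

lemma continuous_jump (hw : ∀ K, Continuous (w K)) (F : m.Face) : Continuous (m.jump w F) :=
  (hw _).sub (m.continuous_outer hw F)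

lemma continuous_avg [NormedSpace ℝ V] (hw : ∀ K, Continuous (w K)) (F : m.Face) :
    Continuous (m.avg w F) := by
  unfold avg
  cases m.snd F with
  | none => exact hw _
  | some K => exact ((hw _).add (hw K)).const_smul (1 / 2 : ℝ)

end Traces

lemma sum_setIntegral_fderiv (hd : 2 ≤ d) {g : m.Scal} (hg : ∀ K, ContDiff ℝ 1 (g K)) (v : E d) :
    ∑ K, ∫ x in m.cell K, fderiv ℝ (g K) x v =
      ∑ F, ⟪m.normal F, v⟫ * surfInt (m.face F) (m.jump g F) := by
  have hcell : ∀ K, ∫ x in m.cell K, fderiv ℝ (g K) x v =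
      ∑ F : m.FaceOf K, ⟪m.outNormal K F, v⟫ * surfInt (m.face F) (g K) := fun K =>
    let ⟨_, hb⟩ := m.exists_facetList K
    hb.setIntegral_fderiv (m.cell_interior K) (one_le_two.trans hd) (hg K) v
  simp_rw [hcell]
  rw [m.sum_cells_faces hd fun K F => ⟪m.outNormal K F, v⟫ * surfInt (m.face F) (g K)]
  refine Finset.sum_congr rfl fun F _ => ?_
  have hgc : ∀ K, Continuous (g K) := fun K => (hg K).continuous
  have hjump : surfInt (m.face F) (m.jump g F) =
      surfInt (m.face F) (g (m.fst F)) - surfInt (m.face F) (m.outer g F) :=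
    integral_sub (m.integrableOn_face F (hgc _)) (m.integrableOn_face F (m.continuous_outer hgc F))
  have hfst : m.outNormal (m.fst F) F = m.normal F := if_pos rfl
  have hsnd : ((m.snd F).elim 0 fun K => ⟪m.outNormal K F, v⟫ * surfInt (m.face F) (g K)) =
      -(⟪m.normal F, v⟫ * surfInt (m.face F) (m.outer g F)) := by
    have hne := m.snd_ne_fst hd F
    unfold outer
    cases h : m.snd F with
    | none => simp [surfInt]
    | some K =>
      have : m.outNormal K F = -m.normal F := if_neg fun h' => hne (by rw [h, h'])
      simp [this, inner_neg_left]
  rw [hjump, hfst, hsnd]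
  ring

/-! ### The trace inequality on shape-regular meshes -/

lemma hF_le (hd : 2 ≤ d) {K : m.Cell} {F : m.Face} (hFK : m.fst F = K ∨ m.snd F = some K) :
    m.hF F ≤ Metric.diam (m.cell K) *
      (volume.real (Metric.closedBall (0 : E (d - 1)) 1)) ^ (1 / ((d : ℝ) - 1)) := by
  obtain ⟨b, h⟩ := (m.isFacet_outNormal K hFK).exists_isFacetAt
  have hcast : ((d - 1 : ℕ) : ℝ) = (d : ℝ) - 1 := Nat.cast_pred (by omega)
  have hd0 : ((d - 1 : ℕ) : ℝ) ≠ 0 := Nat.cast_ne_zero.2 (by omega)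
  have harea : (μHE[d - 1] : Measure (E d)).real (m.face F) ≤
      Metric.diam (m.cell K) ^ (d - 1) * volume.real (Metric.closedBall (0 : E (d - 1)) 1) := by
    refine (ENNReal.toReal_mono (ENNReal.mul_lt_top ENNReal.ofReal_lt_top
      (isCompact_closedBall _ _).measure_lt_top).ne (surface_le h.pos_dim h.norm_eq
        h.subset_hyperplane (m.isCompact_face F).isBounded)).trans ?_
    rw [ENNReal.toReal_mul, ENNReal.toReal_ofReal (pow_nonneg Metric.diam_nonneg _)]
    exact mul_le_mul_of_nonneg_right (pow_le_pow_left₀ Metric.diam_nonneg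
      (Metric.diam_mono h.subset (m.isCompact_cell K).isBounded) _) measureReal_nonneg
  rw [hF, ← hcast]
  refine (Real.rpow_le_rpow measureReal_nonneg harea (by positivity)).trans_eq ?_
  rw [Real.mul_rpow (pow_nonneg Metric.diam_nonneg _) measureReal_nonneg, one_div,
    Real.pow_rpow_inv_natCast Metric.diam_nonneg (Nat.cast_ne_zero.1 hd0)]

lemma bddAbove_inscribed (hd : 1 ≤ d) (K : m.Cell) :
    BddAbove {r : ℝ | 0 ≤ r ∧ ∃ x, Metric.closedBall x r ⊆ m.cell K} := by
  refine ⟨Metric.diam (m.cell K), ?_⟩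
  rintro r ⟨hr, x, hx⟩
  let e : E d := EuclideanSpace.single ⟨0, hd⟩ 1
  have hdist : dist (x + r • e) x = r := by simp [e, norm_smul, abs_of_nonneg hr]
  rw [← hdist]
  exact Metric.dist_le_diam_of_mem (m.isCompact_cell K).isBounded
    (hx (Metric.mem_closedBall.2 hdist.le)) (hx (Metric.mem_closedBall_self hr))

lemma exists_closedBall_subset (hd : 1 ≤ d) {ρ : ℝ} (hm : m.ShapeRegular ρ) (K : m.Cell) :
    ∃ x₀ : E d, ∃ δ > 0, Metric.closedBall x₀ δ ⊆ m.cell K ∧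
      Metric.diam (m.cell K) ≤ 2 * ρ * δ := by
  obtain ⟨x, hx⟩ := m.cell_interior K
  obtain ⟨r, hr, hball⟩ := Metric.nhds_basis_closedBall.mem_iff.1 (mem_interior_iff_mem_nhds.1 hx)
  have hmem : r ∈ {r : ℝ | 0 ≤ r ∧ ∃ x, Metric.closedBall x r ⊆ m.cell K} := ⟨hr.le, x, hball⟩
  have hpos : 0 < inradius (m.cell K) := hr.trans_le (le_csSup (m.bddAbove_inscribed hd K) hmem)
  obtain ⟨δ, ⟨-, x₀, hball₀⟩, hδ⟩ := exists_lt_of_lt_csSup ⟨r, hmem⟩ (half_lt_self hpos)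
  refine ⟨x₀, inradius (m.cell K) / 2, half_pos hpos,
    (Metric.closedBall_subset_closedBall hδ.le).trans hball₀, ?_⟩
  linarith [(div_le_iff₀ hpos).1 (hm K)]

end Geometry

/-- Scaling: by shape regularity, the factor `h_F` is bounded by the radius of a ball inscribed in
each cell adjacent to `F`. -/
lemma exists_trace_constant {d : ℕ} (hd : 2 ≤ d) (r : ℕ) {ρ : ℝ} (hρ : 0 < ρ) :
    ∃ C > 0, ∀ (O : Set (E d)) (m : Mesh O), m.ShapeRegular ρ → ∀ g ∈ m.Ph r,
      ∑ F, m.hF F * (surfInt (m.face F) (fun x => g (m.fst F) x ^ 2) +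
        surfInt (m.face F) fun x => m.outer g F x ^ 2) ≤
      C * ∑ K, ∫ x in m.cell K, g K x ^ 2 := by
  have hd1 : 1 ≤ d := one_le_two.trans hd
  obtain ⟨C₁, hC₁, htrace⟩ := exists_eval_one_sq_le (d - 1) r
  set c := (volume.real (Metric.closedBall (0 : E (d - 1)) 1)) ^ (1 / ((d : ℝ) - 1))
  have hc0 : 0 < c := Real.rpow_pos_of_pos (ENNReal.toReal_pos
    (Metric.measure_closedBall_pos _ _ one_pos).ne' (isCompact_closedBall _ _).measure_lt_top.ne) _
  refine ⟨2 * ρ * c * C₁, by positivity, fun O m hm g hg => ?_⟩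
  have hcell : ∀ K, ∑ F : m.FaceOf K, m.hF F * surfInt (m.face F) (fun x => g K x ^ 2) ≤
      2 * ρ * c * C₁ * ∫ x in m.cell K, g K x ^ 2 := by
    intro K
    obtain ⟨b, hb⟩ := m.exists_facetList K
    obtain ⟨x₀, δ, hδ, hball, hdiam⟩ := m.exists_closedBall_subset hd1 hm K
    calc ∑ F : m.FaceOf K, m.hF F * surfInt (m.face F) (fun x => g K x ^ 2)
        ≤ ∑ F : m.FaceOf K, 2 * ρ * δ * c * surfInt (m.face F) (fun x => g K x ^ 2) := by
          gcongr with F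
          · exact integral_nonneg fun x => sq_nonneg _
          · exact (m.hF_le hd F.2).trans (mul_le_mul_of_nonneg_right hdiam hc0.le)
      _ = 2 * ρ * c * (δ * ∑ F : m.FaceOf K, surfInt (m.face F) fun x => g K x ^ 2) := by
          rw [← Finset.mul_sum]; ring
      _ ≤ 2 * ρ * c * (C₁ * ∫ x in m.cell K, g K x ^ 2) :=
          mul_le_mul_of_nonneg_left (hb.mul_sum_surfInt_sq_le hd1 htrace hδ hball (hg K))
            (by positivity)
      _ = _ := by ring
  rw [Finset.mul_sum]
  refine le_of_eq_of_le ?_ (Finset.sum_le_sum fun K _ => hcell K)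
  rw [m.sum_cells_faces hd fun K F => m.hF F * surfInt (m.face F) fun x => g K x ^ 2]
  refine Finset.sum_congr rfl fun F _ => ?_
  rw [mul_add]
  unfold outer
  cases m.snd F <;> simp [surfInt]

section Regularity

variable {d : ℕ} {O : Set (E d)} {m : Mesh O} {r : ℕ} {w : m.Vec} {g : m.Scal}

/-! ### Regularity of discrete functions -/

lemma contDiff_of_mem_Mh (hw : w ∈ m.Mh r) (K : m.Cell) : ContDiff ℝ 1 (w K) :=
  contDiff_euclidean.2 fun i => contDiff_of_mem_polyFun (hw K i)

lemma contDiff_of_mem_Ph (hg : g ∈ m.Ph r) (K : m.Cell) : ContDiff ℝ 1 (g K) :=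
  contDiff_of_mem_polyFun (hg K)

lemma continuous_of_mem_Mh (hw : w ∈ m.Mh r) (K : m.Cell) : Continuous (w K) :=
  (contDiff_of_mem_Mh hw K).continuous

lemma continuous_of_mem_Ph (hg : g ∈ m.Ph r) (K : m.Cell) : Continuous (g K) :=
  (contDiff_of_mem_Ph hg K).continuous

lemma differentiable_of_mem_Mh (hw : w ∈ m.Mh r) (K : m.Cell) : Differentiable ℝ (w K) :=
  (contDiff_of_mem_Mh hw K).differentiable one_ne_zero

lemma continuous_jac (hw : w ∈ m.Mh r) (K : m.Cell) : Continuous (m.jac w K) :=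
  (contDiff_of_mem_Mh hw K).continuous_fderiv one_ne_zero

lemma continuous_grad (hg : g ∈ m.Ph r) (K : m.Cell) : Continuous (m.grad g K) :=
  (InnerProductSpace.toDual ℝ (E d)).symm.continuous.comp
    ((contDiff_of_mem_Ph hg K).continuous_fderiv one_ne_zero)

lemma continuous_div (hw : w ∈ m.Mh r) (K : m.Cell) : Continuous (div (w K)) :=
  continuous_finsetSum _ fun j _ => (EuclideanSpace.proj j : E d →L[ℝ] ℝ).continuous.comp
    ((continuous_jac hw K).clm_apply continuous_const)

lemma _root_.DGOldroyd.fderiv_coord {w : E d → E d} (hw : Differentiable ℝ w) (x v : E d)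
    (i : Fin d) : (fderiv ℝ w x v) i = fderiv ℝ (fun y => w y i) x v :=
  (congrArg (· v)
    (((EuclideanSpace.proj i : E d →L[ℝ] ℝ).hasFDerivAt.comp x (hw x).hasFDerivAt).fderiv)).symm

lemma coord_mem_Ph (hw : w ∈ m.Mh r) (i : Fin d) : (fun K x => w K x i) ∈ m.Ph r :=
  fun K => hw K i

lemma fderiv_mem_Ph (hg : g ∈ m.Ph r) (v : E d) : (fun K x => fderiv ℝ (g K) x v) ∈ m.Ph r :=
  fun K => fderiv_apply_mem_polyFun (hg K) v

lemma fderiv_coord_mem_Ph (hw : w ∈ m.Mh r) (v : E d) (i : Fin d) :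
    (fun K x => (fderiv ℝ (w K) x v) i) ∈ m.Ph r := by
  simp only [fderiv_coord (differentiable_of_mem_Mh hw _)]
  exact fderiv_mem_Ph (coord_mem_Ph hw i) v

end Regularity

end Mesh

/-! ### Coercivity for large penalty parameters -/

lemma le_of_sq_le_mul {a j f c : ℝ} (hc : 0 < c) (ha : 0 ≤ a) (hj : 0 ≤ j) (hf : f ^ 2 ≤ a * j) :
    f ≤ c⁻¹ * a + c / 4 * j := by
  have hprod : c⁻¹ * a * (c / 4 * j) = a * j / 4 := by field_simp
  refine (abs_le_of_sq_le_sq' ?_ (by positivity)).2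
  linarith [sq_nonneg (c⁻¹ * a - c / 4 * j)]

section Gradient

variable {d : ℕ}

lemma norm_sq_le_sum_sq (A : E d →L[ℝ] E d) :
    ‖A‖ ^ 2 ≤ ∑ p : Fin d × Fin d, (A (EuclideanSpace.single p.1 1)) p.2 ^ 2 := by
  refine (pow_le_pow_left₀ (norm_nonneg A) (A.opNorm_le_bound (Real.sqrt_nonneg _) fun v => ?_)
    2).trans_eq (Real.sq_sqrt (Finset.sum_nonneg fun p _ => sq_nonneg _))
  rw [← Real.sqrt_sq (norm_nonneg v), ← Real.sqrt_mul (by positivity)]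
  refine Real.le_sqrt_of_sq_le ?_
  have hcoord : ∀ i, A v i = ∑ j, A (EuclideanSpace.single j 1) i * v j := fun i => by
    conv_lhs => rw [← (EuclideanSpace.basisFun (Fin d) ℝ).sum_repr v]
    simp [mul_comm]
  rw [EuclideanSpace.real_norm_sq_eq, Fintype.sum_prod_type_right, Finset.sum_mul]
  refine Finset.sum_le_sum fun i _ => ?_
  rw [hcoord, EuclideanSpace.real_norm_sq_eq]
  exact Finset.sum_mul_sq_le_sq_mul_sq _ _ _

lemma gradDot_self (w : E d → E d) (x : E d) :
    gradDot w w x =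
      ∑ p : Fin d × Fin d, (fderiv ℝ w x (EuclideanSpace.single p.1 1)) p.2 ^ 2 := by
  simp only [gradDot, real_inner_self_eq_norm_sq, EuclideanSpace.real_norm_sq_eq,
    Fintype.sum_prod_type]

lemma inner_gradient (g : E d → ℝ) (x v : E d) : ⟪gradient g x, v⟫ = fderiv ℝ g x v := by
  simp [gradient]

lemma norm_sq_gradient (g : E d → ℝ) (x : E d) :
    ‖gradient g x‖ ^ 2 = ∑ j, (fderiv ℝ g x (EuclideanSpace.single j 1)) ^ 2 := by
  simp only [EuclideanSpace.real_norm_sq_eq, ← inner_gradient, EuclideanSpace.inner_single_right,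
    one_mul, conj_trivial]

end Gradient

namespace Mesh

section Penalty

variable {d : ℕ} {O : Set (E d)} (m : Mesh O) {r : ℕ}

lemma surfInt_nonneg {d : ℕ} {S : Set (E d)} {g : E d → ℝ} (hg : ∀ x, 0 ≤ g x) :
    0 ≤ surfInt S g :=
  integral_nonneg hg

lemma norm_avg_sq_le {V : Type*} [NormedAddCommGroup V] [NormedSpace ℝ V] (w : m.Cell → E d → V)
    (F : m.Face) (x : E d) :
    ‖m.avg w F x‖ ^ 2 ≤ ‖w (m.fst F) x‖ ^ 2 + ‖m.outer w F x‖ ^ 2 := by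
  unfold avg outer
  cases m.snd F with
  | none => simp
  | some K =>
    rw [Option.elim_some, Option.elim_some, norm_smul, mul_pow]
    have hle := pow_le_pow_left₀ (norm_nonneg _) (norm_add_le (w (m.fst F) x) (w K x)) 2
    norm_num
    linarith [sq_nonneg (‖w (m.fst F) x‖ - ‖w K x‖), sq_nonneg ‖w (m.fst F) x‖,
      sq_nonneg ‖w K x‖]

lemma norm_jac_avg_sq_le (w : m.Vec) (F : m.Face) (x : E d) :
    ‖m.avg (m.jac w) F x‖ ^ 2 ≤ ∑ p : Fin d × Fin d,
      ((fderiv ℝ (w (m.fst F)) x (EuclideanSpace.single p.1 1)) p.2 ^ 2 +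
        m.outer (fun K x => (fderiv ℝ (w K) x (EuclideanSpace.single p.1 1)) p.2) F x ^ 2) := by
  refine (m.norm_avg_sq_le _ F x).trans ?_
  rw [Finset.sum_add_distrib]
  refine add_le_add (norm_sq_le_sum_sq _) ?_
  unfold outer
  cases m.snd F with
  | none => simp
  | some K => exact norm_sq_le_sum_sq _

lemma norm_grad_avg_sq_le (g : m.Scal) (F : m.Face) (x : E d) :
    ‖m.avg (m.grad g) F x‖ ^ 2 ≤ ∑ j,
      ((fderiv ℝ (g (m.fst F)) x (EuclideanSpace.single j 1)) ^ 2 +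
        m.outer (fun K x => fderiv ℝ (g K) x (EuclideanSpace.single j 1)) F x ^ 2) := by
  refine (m.norm_avg_sq_le _ F x).trans ?_
  rw [Finset.sum_add_distrib]
  refine add_le_add (norm_sq_gradient _ x).le ?_
  unfold outer
  cases m.snd F with
  | none => simp
  | some K => exact (norm_sq_gradient _ x).le

lemma sum_hF_mul_surfInt_le (hd : 2 ≤ d) {C : ℝ}
    (htrace : ∀ g ∈ m.Ph r,
      ∑ F, m.hF F * (surfInt (m.face F) (fun x => g (m.fst F) x ^ 2) +
        surfInt (m.face F) fun x => m.outer g F x ^ 2) ≤ C * ∑ K, ∫ x in m.cell K, g K x ^ 2)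
    {ι : Type*} [Fintype ι] {g : ι → m.Scal} (hg : ∀ i, g i ∈ m.Ph r) (s : Finset m.Face) :
    ∑ F ∈ s, m.hF F * surfInt (m.face F)
        (fun x => ∑ i, (g i (m.fst F) x ^ 2 + m.outer (g i) F x ^ 2)) ≤
      C * ∑ K, ∫ x in m.cell K, ∑ i, g i K x ^ 2 := by
  have hgc := fun i => continuous_of_mem_Ph (hg i)
  have hsurf : ∀ F, surfInt (m.face F)
      (fun x => ∑ i, (g i (m.fst F) x ^ 2 + m.outer (g i) F x ^ 2)) =
      ∑ i, (surfInt (m.face F) (fun x => g i (m.fst F) x ^ 2) +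
        surfInt (m.face F) fun x => m.outer (g i) F x ^ 2) := by
    intro F
    have hfst := fun i => m.integrableOn_face F ((hgc i (m.fst F)).pow 2)
    have hsnd := fun i => m.integrableOn_face F ((m.continuous_outer (hgc i) F).pow 2)
    exact (integral_finsetSum _ fun i _ => (hfst i).add (hsnd i)).trans
      (Finset.sum_congr rfl fun i _ => integral_add (hfst i) (hsnd i))
  have hcell : ∑ K, ∫ x in m.cell K, ∑ i, g i K x ^ 2 =
      ∑ i, ∑ K, ∫ x in m.cell K, g i K x ^ 2 := by
    rw [Finset.sum_comm]
    exact Finset.sum_congr rfl fun K _ =>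
      integral_finsetSum _ fun i _ => m.integrableOn_cell K ((hgc i K).pow 2)
  refine (Finset.sum_le_univ_sum_of_nonneg fun F => mul_nonneg (m.hF_pos hd F).le
    (surfInt_nonneg fun x => Finset.sum_nonneg fun i _ => by positivity)).trans ?_
  simp only [hsurf, hcell, Finset.mul_sum]
  rw [Finset.sum_comm]
  refine Finset.sum_le_sum fun i _ => ?_
  simpa only [Finset.mul_sum] using htrace (g i) (hg i)

lemma surfInt_le_of_sq_le_mul (F : m.Face) {c : ℝ} (hc : 0 < c) {f A J : E d → ℝ}
    (hf : Continuous f) (hA : Continuous A) (hJ : Continuous J) (hA0 : ∀ x, 0 ≤ A x)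
    (hJ0 : ∀ x, 0 ≤ J x) (hle : ∀ x, f x ^ 2 ≤ A x * J x) :
    surfInt (m.face F) f ≤ c⁻¹ * surfInt (m.face F) A + c / 4 * surfInt (m.face F) J := by
  have hAi := (m.integrableOn_face F hA).const_mul c⁻¹
  have hJi := (m.integrableOn_face F hJ).const_mul (c / 4)
  refine (setIntegral_mono (m.integrableOn_face F hf) (hAi.add hJi) fun x =>
    le_of_sq_le_mul hc (hA0 x) (hJ0 x) (hle x)).trans_eq ?_
  simp only [surfInt, ← integral_const_mul]
  exact integral_add hAi hJi

end Penalty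

/-- Absorption of the consistency terms `f`, with `g` the components of the gradient and `J` the
square of the jump. -/
lemma exists_sum_surfInt_le {d : ℕ} (hd : 2 ≤ d) (r : ℕ) {ρ : ℝ} (hρ : 0 < ρ) :
    ∃ σ₀ > 0, ∀ (O : Set (E d)) (m : Mesh O), m.ShapeRegular ρ → ∀ σ ≥ σ₀,
      ∀ {ι : Type} [Fintype ι] {g : ι → m.Scal}, (∀ i, g i ∈ m.Ph r) →
      ∀ (s : Finset m.Face) {f J : m.Face → E d → ℝ}, (∀ F, Continuous (f F)) →
      (∀ F, Continuous (J F)) → (∀ F x, 0 ≤ J F x) →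
      (∀ F x, f F x ^ 2 ≤ (∑ i, (g i (m.fst F) x ^ 2 + m.outer (g i) F x ^ 2)) * J F x) →
      ∑ F ∈ s, surfInt (m.face F) (f F) ≤ 1 / 4 * ((∑ K, ∫ x in m.cell K, ∑ i, g i K x ^ 2) +
        ∑ F ∈ s, σ / m.hF F * surfInt (m.face F) (J F)) := by
  obtain ⟨C, hC, htrace⟩ := exists_trace_constant hd r hρ
  refine ⟨4 * C, by positivity, fun O m hm σ hσ ι _ g hg s f J hf hJ hJ0 hle => ?_⟩
  have hσ0 : 0 < σ := by linarith
  set A : m.Face → E d → ℝ := fun F x => ∑ i, (g i (m.fst F) x ^ 2 + m.outer (g i) F x ^ 2)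
  have hA : ∀ F, Continuous (A F) := fun F => continuous_finsetSum _ fun i _ =>
    ((continuous_of_mem_Ph (hg i) _).pow 2).add
      ((m.continuous_outer (continuous_of_mem_Ph (hg i)) F).pow 2)
  have hA0 : ∀ F x, 0 ≤ A F x := fun F x => Finset.sum_nonneg fun i _ => by positivity
  have hface : ∀ F, surfInt (m.face F) (f F) ≤
      σ⁻¹ * (m.hF F * surfInt (m.face F) (A F)) +
        1 / 4 * (σ / m.hF F * surfInt (m.face F) (J F)) := by
    intro F
    refine (m.surfInt_le_of_sq_le_mul F (div_pos hσ0 (m.hF_pos hd F)) (hf F) (hA F) (hJ F)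
      (hA0 F) (hJ0 F) (hle F)).trans_eq ?_
    rw [inv_div]
    ring
  calc ∑ F ∈ s, surfInt (m.face F) (f F)
      ≤ σ⁻¹ * ∑ F ∈ s, m.hF F * surfInt (m.face F) (A F) +
          1 / 4 * ∑ F ∈ s, σ / m.hF F * surfInt (m.face F) (J F) := by
        rw [Finset.mul_sum, Finset.mul_sum, ← Finset.sum_add_distrib]
        exact Finset.sum_le_sum fun F _ => hface F
    _ ≤ σ⁻¹ * (σ / 4 * ∑ K, ∫ x in m.cell K, ∑ i, g i K x ^ 2) +
          1 / 4 * ∑ F ∈ s, σ / m.hF F * surfInt (m.face F) (J F) := by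
        gcongr
        refine (m.sum_hF_mul_surfInt_le hd (htrace O m hm) hg s).trans ?_
        refine mul_le_mul_of_nonneg_right (by linarith) ?_
        exact Finset.sum_nonneg fun K _ => integral_nonneg fun x =>
          Finset.sum_nonneg fun i _ => sq_nonneg _
    _ = _ := by
        field_simp

section Coercivity

variable {d : ℕ} {O : Set (E d)} (m : Mesh O)

lemma Aeps_self (ε σ : ℝ) (w : m.Vec) : m.Aeps ε σ w w = m.normSqVec σ w - (1 - ε) *
    ∑ F, surfInt (m.face F) fun x => ⟪m.avg (m.jac w) F x (m.normal F), m.jump w F x⟫ := by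
  simp only [Aeps, normSqVec, real_inner_self_eq_norm_sq]
  ring

lemma Asip_self (σ' : ℝ) (g : m.Scal) : m.Asip σ' g g = m.normSqScal σ' g - 2 *
    ∑ F ∈ m.intFaces, surfInt (m.face F) fun x =>
      ⟪m.avg (m.grad g) F x, m.normal F⟫ * m.jump g F x := by
  simp only [Asip, normSqScal, real_inner_self_eq_norm_sq, sq]
  ring

lemma normSqVec_nonneg (hd : 2 ≤ d) {σ : ℝ} (hσ : 0 < σ) (w : m.Vec) : 0 ≤ m.normSqVec σ w := by
  refine add_nonneg (Finset.sum_nonneg fun K _ => integral_nonneg fun x => ?_)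
    (Finset.sum_nonneg fun F _ => mul_nonneg (div_pos hσ (m.hF_pos hd F)).le
      (surfInt_nonneg fun x => sq_nonneg _))
  rw [gradDot_self]
  exact Finset.sum_nonneg fun p _ => sq_nonneg _

lemma coerciveVel_one (r : ℕ) (σ : ℝ) : m.CoerciveVel r 1 σ := fun w _ => by
  rw [omega, if_pos rfl, m.Aeps_self, sub_self, zero_mul, sub_zero, one_mul]

end Coercivity

theorem exists_coerciveVel {d : ℕ} (hd : 2 ≤ d) (r : ℕ) {ρ : ℝ} (hρ : 0 < ρ) :
    ∃ σ₀ > 0, ∀ (O : Set (E d)) (m : Mesh O), m.ShapeRegular ρ →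
      ∀ ε ∈ Icc (-1) 1, ∀ σ ≥ σ₀, m.CoerciveVel r ε σ := by
  obtain ⟨σ₀, hσ₀, h⟩ := exists_sum_surfInt_le hd r hρ
  refine ⟨σ₀, hσ₀, fun O m hm ε hε σ hσ => ?_⟩
  obtain rfl | hne := eq_or_ne ε 1
  · exact m.coerciveVel_one r σ
  intro w hw
  have hjump := fun F => m.continuous_jump (continuous_of_mem_Mh hw) F
  have habsorb := h O m hm σ hσ
    (fun p : Fin d × Fin d => fderiv_coord_mem_Ph hw (EuclideanSpace.single p.1 1) p.2)
    Finset.univ (f := fun F x => ⟪m.avg (m.jac w) F x (m.normal F), m.jump w F x⟫)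
    (J := fun F x => ‖m.jump w F x‖ ^ 2)
    (fun F => ((m.continuous_avg (continuous_jac hw) F).clm_apply continuous_const).inner
      (hjump F))
    (fun F => (hjump F).norm.pow 2) (fun F x => sq_nonneg _) fun F x => ?_
  · simp only [← gradDot_self] at habsorb
    change _ ≤ 1 / 4 * m.normSqVec σ w at habsorb
    rw [omega, if_neg hne, m.Aeps_self]
    nlinarith [mul_le_mul_of_nonneg_left habsorb (sub_nonneg.2 hε.2),
      mul_nonneg (neg_le_iff_add_nonneg.1 hε.1)
        (m.normSqVec_nonneg hd (hσ₀.trans_le hσ) w)]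
  · refine le_trans ?_ (mul_le_mul_of_nonneg_right (m.norm_jac_avg_sq_le w F x) (sq_nonneg _))
    have hnorm := (m.avg (m.jac w) F x).le_opNorm (m.normal F)
    rw [(m.fst_facet F).1, mul_one] at hnorm
    rw [← mul_pow, ← sq_abs]
    exact pow_le_pow_left₀ (abs_nonneg _) ((abs_real_inner_le_norm _ _).trans
      (mul_le_mul_of_nonneg_right hnorm (norm_nonneg _))) 2

theorem exists_coerciveSip {d : ℕ} (hd : 2 ≤ d) (r : ℕ) {ρ : ℝ} (hρ : 0 < ρ) :
    ∃ σ₀ > 0, ∀ (O : Set (E d)) (m : Mesh O), m.ShapeRegular ρ →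
      ∀ σ' ≥ σ₀, m.CoerciveSip r σ' := by
  obtain ⟨σ₀, hσ₀, h⟩ := exists_sum_surfInt_le hd r hρ
  refine ⟨σ₀, hσ₀, fun O m hm σ hσ p hp => ?_⟩
  have hjump := fun F => m.continuous_jump (continuous_of_mem_Ph hp) F
  have habsorb := h O m hm σ hσ (fun j => fderiv_mem_Ph hp (EuclideanSpace.single j 1))
    m.intFaces (f := fun F x => ⟪m.avg (m.grad p) F x, m.normal F⟫ * m.jump p F x)
    (J := fun F x => m.jump p F x ^ 2)
    (fun F => ((m.continuous_avg (continuous_grad hp) F).inner continuous_const).mul (hjump F))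
    (fun F => (hjump F).pow 2) (fun F x => sq_nonneg _) fun F x => ?_
  · simp only [← norm_sq_gradient] at habsorb
    change _ ≤ 1 / 4 * m.normSqScal σ p at habsorb
    rw [m.Asip_self]
    linarith
  · rw [mul_pow]
    refine mul_le_mul_of_nonneg_right (le_trans ?_ (m.norm_grad_avg_sq_le p F x)) (sq_nonneg _)
    have hnorm := abs_real_inner_le_norm (m.avg (m.grad p) F x) (m.normal F)
    rw [(m.fst_facet F).1, mul_one] at hnorm
    exact sq_le_sq.2 (hnorm.trans (le_abs_self _))

end Mesh

/-! ### Consequences of the divergence theorem -/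

section Upwind

variable {d : ℕ}

lemma div_normSq_smul {z φ : E d → E d} (hz : Differentiable ℝ z) (hφ : Differentiable ℝ φ)
    (x : E d) :
    div (fun y => ‖φ y‖ ^ 2 • z y) x = 2 * ⟪fderiv ℝ φ x (z x), φ x⟫ + div z x * ‖φ x‖ ^ 2 := by
  have hfderiv : fderiv ℝ φ x (z x) =
      ∑ j, z x j • fderiv ℝ φ x (EuclideanSpace.single j 1) := by
    conv_lhs => rw [← (EuclideanSpace.basisFun (Fin d) ℝ).sum_repr (z x)]
    simp
  unfold div
  rw [hfderiv, sum_inner, Finset.mul_sum, Finset.sum_mul, ← Finset.sum_add_distrib]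
  refine Finset.sum_congr rfl fun j _ => ?_
  rw [fderiv_fun_smul ((hφ x).norm_sq ℝ) (hz x), (hφ x).hasFDerivAt.norm_sq.fderiv]
  simp only [add_apply, smul_apply, ContinuousLinearMap.smulRight_apply, PiLp.add_apply,
    PiLp.smul_apply, smul_eq_mul, ContinuousLinearMap.comp_apply, innerSL_apply_apply,
    real_inner_smul_left, nsmul_eq_mul, Nat.cast_ofNat]
  rw [real_inner_comm (φ x)]
  ring

lemma upwind_identity (a : ℝ) (x y : E d) :
    1 / 2 * (a * (‖x‖ ^ 2 - ‖y‖ ^ 2)) + (if a < 0 then |a| * ⟪x - y, x⟫ else 0) +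
      (if 0 < a then |a| * ⟪y - x, y⟫ else 0) = 1 / 2 * (|a| * ‖x - y‖ ^ 2) := by
  rw [norm_sub_sq_real, inner_sub_left, inner_sub_left, real_inner_self_eq_norm_sq,
    real_inner_self_eq_norm_sq, real_inner_comm y x]
  rcases lt_trichotomy a 0 with ha | rfl | ha
  · rw [if_pos ha, if_neg ha.not_gt, abs_of_neg ha]
    ring
  · simp
  · rw [if_neg ha.not_gt, if_pos ha, abs_of_pos ha]
    ring

end Upwind

namespace Mesh

section Divergence

variable {d : ℕ} {O : Set (E d)} (m : Mesh O) {r r' : ℕ}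

lemma jump_coord (W : m.Vec) (F : m.Face) (x : E d) (j : Fin d) :
    m.jump W F x j = m.jump (fun K y => W K y j) F x := by
  unfold jump outer
  cases m.snd F <;> rfl

lemma sum_setIntegral_div (hd : 2 ≤ d) {W : m.Vec} (hW : ∀ K, ContDiff ℝ 1 (W K)) :
    ∑ K, ∫ x in m.cell K, div (W K) x =
      ∑ F, surfInt (m.face F) fun x => ⟪m.normal F, m.jump W F x⟫ := by
  have hWj : ∀ j K, ContDiff ℝ 1 fun x => W K x j := fun j K => contDiff_euclidean.1 (hW K) j
  have hcell : ∀ K, ∫ x in m.cell K, div (W K) x =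
      ∑ j, ∫ x in m.cell K, fderiv ℝ (fun y => W K y j) x (EuclideanSpace.single j 1) := by
    intro K
    simp only [div, fderiv_coord ((hW K).differentiable one_ne_zero)]
    exact integral_finsetSum _ fun j _ => m.integrableOn_cell K
      (((hWj j K).continuous_fderiv one_ne_zero).clm_apply continuous_const)
  have hface : ∀ F, surfInt (m.face F) (fun x => ⟪m.normal F, m.jump W F x⟫) =
      ∑ j, m.normal F j * surfInt (m.face F) (m.jump (fun K y => W K y j) F) := by
    intro F
    simp only [surfInt, ← integral_const_mul, PiLp.inner_apply, jump_coord]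
    refine (integral_finsetSum _ fun j _ => ?_).trans ?_
    · exact m.integrableOn_face F
        (continuous_const.inner (m.continuous_jump (fun K => (hWj j K).continuous) F))
    · simp [mul_comm]
  simp only [hcell, hface]
  rw [Finset.sum_comm, Finset.sum_comm (s := Finset.univ (α := m.Face))]
  refine Finset.sum_congr rfl fun j _ => ?_
  simpa [EuclideanSpace.inner_single_right] using
    m.sum_setIntegral_fderiv hd (hWj j) (EuclideanSpace.single j 1)

lemma b_const_one (hd : 2 ≤ d) {w : m.Vec} (hw : w ∈ m.Mh r) : m.b w (fun _ _ => 1) = 0 := by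
  have havg : ∀ F x, m.avg (fun _ _ => (1 : ℝ)) F x = 1 := by
    intro F x
    unfold avg
    cases m.snd F with
    | none => rfl
    | some K => norm_num
  simp only [b, havg, mul_one, one_mul, m.sum_setIntegral_div hd (contDiff_of_mem_Mh hw), sub_self]

lemma jump_smul_of_interior {F : m.Face} (hF : (m.snd F).isSome) (c : m.Scal) (z : m.Vec)
    (x : E d) : m.jump (fun K y => c K y • z K y) F x =
      m.avg c F x • m.jump z F x + m.jump c F x • m.avg z F x := by
  obtain ⟨K, hK⟩ := Option.isSome_iff_exists.1 hF
  simp only [jump, avg, outer, hK, Option.elim_some, smul_eq_mul]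
  module

lemma jump_smul_of_boundary {F : m.Face} (hF : ¬ (m.snd F).isSome) (c : m.Scal) (z : m.Vec)
    (x : E d) : m.jump (fun K y => c K y • z K y) F x = m.avg c F x • m.jump z F x := by
  simp [jump, avg, outer, Option.not_isSome_iff_eq_none.1 hF]

lemma surfInt_inflow {θ : m.Vec} (hθ : ∀ K, Continuous (θ K)) (F : m.Face) (s : ℝ)
    (f : E d → ℝ) : surfInt (m.inflow θ F s) f =
      surfInt (m.face F) ({x | ⟪m.avg θ F x, s • m.normal F⟫ < 0}.indicator f) := by
  unfold surfInt
  rw [setIntegral_indicator (isOpen_lt ((m.continuous_avg hθ F).inner continuous_const)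
    continuous_const).measurableSet]
  rfl

lemma integrableOn_indicator_inflow {θ : m.Vec} (hθ : ∀ K, Continuous (θ K)) (F : m.Face) (s : ℝ)
    {f : E d → ℝ} (hf : Continuous f) :
    IntegrableOn ({x | ⟪m.avg θ F x, s • m.normal F⟫ < 0}.indicator f) (m.face F) μHE[d - 1] :=
  (m.integrableOn_face F hf).indicator
    (isOpen_lt ((m.continuous_avg hθ F).inner continuous_const) continuous_const).measurableSet

lemma surfInt_upwind (F : m.Face) {z φ : m.Vec} (hz : ∀ K, Continuous (z K))
    (hφ : ∀ K, Continuous (φ K)) :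
    1 / 2 * surfInt (m.face F) (fun x => ⟪m.avg z F x, m.normal F⟫ *
        (‖φ (m.fst F) x‖ ^ 2 - ‖m.outer φ F x‖ ^ 2)) +
      surfInt (m.inflow z F 1) (fun x =>
        |⟪m.avg z F x, m.normal F⟫| * ⟪φ (m.fst F) x - m.outer φ F x, φ (m.fst F) x⟫) +
      surfInt (m.inflow z F (-1)) (fun x =>
        |⟪m.avg z F x, m.normal F⟫| * ⟪m.outer φ F x - φ (m.fst F) x, m.outer φ F x⟫) =
    1 / 2 * surfInt (m.face F) fun x =>
      |⟪m.avg z F x, m.normal F⟫| * ‖m.jump φ F x‖ ^ 2 := by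
  have ha : Continuous fun x => ⟪m.avg z F x, m.normal F⟫ :=
    (m.continuous_avg hz F).inner continuous_const
  have hφo := m.continuous_outer hφ F
  have hcentral := (m.integrableOn_face F
    (ha.mul (((hφ (m.fst F)).norm.pow 2).sub (hφo.norm.pow 2)))).const_mul (1 / 2)
  have hin := m.integrableOn_indicator_inflow hz F 1
    (ha.abs.mul (((hφ (m.fst F)).sub hφo).inner (hφ (m.fst F))))
  have hout := m.integrableOn_indicator_inflow hz F (-1)
    (ha.abs.mul ((hφo.sub (hφ (m.fst F))).inner hφo))
  rw [m.surfInt_inflow hz, m.surfInt_inflow hz]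
  simp only [surfInt, ← integral_const_mul]
  refine (congrArg (· + _) (integral_add hcentral hin).symm).trans
    ((integral_add (hcentral.add hin) hout).symm.trans
      (integral_congr_ae (ae_of_all _ fun x => ?_)))
  simpa [indicator_apply, jump] using
    upwind_identity ⟪m.avg z F x, m.normal F⟫ (φ (m.fst F) x) (m.outer φ F x)

lemma setIntegral_convection_self {z φ : m.Vec} (hz : z ∈ m.Mh r) (hφ : φ ∈ m.Mh r')
    (K : m.Cell) :
    (∫ x in m.cell K, ⟪fderiv ℝ (φ K) x (z K x), φ K x⟫)
        + (1 / 2) * ∫ x in m.cell K, div (z K) x * ‖φ K x‖ ^ 2 =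
      1 / 2 * ∫ x in m.cell K, div (fun y => ‖φ K y‖ ^ 2 • z K y) x := by
  have hφc := continuous_of_mem_Mh hφ K
  simp only [div_normSq_smul (differentiable_of_mem_Mh hz K) (differentiable_of_mem_Mh hφ K)]
  rw [integral_add, integral_const_mul]
  · ring
  · exact m.integrableOn_cell K
      ((((continuous_jac hφ K).clm_apply (continuous_of_mem_Mh hz K)).inner hφc).const_mul 2)
  · exact m.integrableOn_cell K ((continuous_div hz K).mul (hφc.norm.pow 2))

lemma sum_convection_self (hd : 2 ≤ d) {z φ : m.Vec} (hz : z ∈ m.Mh r) (hφ : φ ∈ m.Mh r') :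
    (∑ K, ((∫ x in m.cell K, ⟪fderiv ℝ (φ K) x (z K x), φ K x⟫)
        + (1 / 2) * ∫ x in m.cell K, div (z K) x * ‖φ K x‖ ^ 2))
      - (1 / 2) * ∑ F, surfInt (m.face F) (fun x =>
        ⟪m.jump z F x, m.normal F⟫ * m.avg (fun K y => ‖φ K y‖ ^ 2) F x) =
    ∑ F ∈ m.intFaces, 1 / 2 * surfInt (m.face F) fun x => ⟪m.avg z F x, m.normal F⟫ *
        (‖φ (m.fst F) x‖ ^ 2 - ‖m.outer φ F x‖ ^ 2) := by
  have hzc := continuous_of_mem_Mh hz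
  have hc : ∀ K, ContDiff ℝ 1 fun y => ‖φ K y‖ ^ 2 := fun K => (contDiff_of_mem_Mh hφ K).norm_sq ℝ
  have hW : ∀ K, ContDiff ℝ 1 fun y => ‖φ K y‖ ^ 2 • z K y := fun K =>
    (hc K).smul (contDiff_of_mem_Mh hz K)
  simp only [m.setIntegral_convection_self hz hφ]
  rw [← Finset.mul_sum, m.sum_setIntegral_div hd hW, intFaces, Finset.sum_filter, ← mul_sub,
    ← Finset.sum_sub_distrib, Finset.mul_sum]
  refine Finset.sum_congr rfl fun F _ => ?_
  have hflux : IntegrableOn (fun x => ⟪m.normal F, m.jump (fun K y => ‖φ K y‖ ^ 2 • z K y) F x⟫)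
      (m.face F) μHE[d - 1] := m.integrableOn_face F
    (continuous_const.inner (m.continuous_jump (fun K => (hW K).continuous) F))
  have hjump : IntegrableOn (fun x => ⟪m.jump z F x, m.normal F⟫ *
      m.avg (fun K y => ‖φ K y‖ ^ 2) F x) (m.face F) μHE[d - 1] := m.integrableOn_face F
    (((m.continuous_jump hzc F).inner continuous_const).mul
      (m.continuous_avg (fun K => (hc K).continuous) F))
  rw [surfInt, surfInt, ← integral_sub hflux hjump]
  split_ifs with hF
  · congr 2 with x
    obtain ⟨K, hK⟩ := Option.isSome_iff_exists.1 hF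
    have hsq : m.jump (fun K y => ‖φ K y‖ ^ 2) F x =
        ‖φ (m.fst F) x‖ ^ 2 - ‖m.outer φ F x‖ ^ 2 := by
      simp [jump, outer, hK]
    rw [m.jump_smul_of_interior hF, inner_add_right, real_inner_smul_right, real_inner_smul_right,
      real_inner_comm (m.avg z F x), real_inner_comm (m.jump z F x), hsq]
    ring
  · simp only [m.jump_smul_of_boundary hF, real_inner_smul_right, real_inner_comm (m.normal F)]
    simp [mul_comm]

/-- Upwinding turns the convection form into half the integral of `|{z} · n_F| |[φ]|²` over the
interior faces, up to the inflow part of the boundary. -/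
lemma Ac_self_nonneg (hd : 2 ≤ d) {z φ : m.Vec} (hz : z ∈ m.Mh r) (hφ : φ ∈ m.Mh r') :
    0 ≤ m.Ac z z φ φ := by
  classical
  simp only [Ac, real_inner_self_eq_norm_sq]
  rw [m.sum_convection_self hd hz hφ, ← Finset.sum_add_sum_compl m.intFaces, ← add_assoc,
    add_right_comm, ← Finset.sum_add_distrib, ← Finset.sum_add_distrib]
  refine add_nonneg (Finset.sum_nonneg fun F _ => ?_) (Finset.sum_nonneg fun F hF => ?_)
  · rw [m.surfInt_upwind F (continuous_of_mem_Mh hz) (continuous_of_mem_Mh hφ)]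
    exact mul_nonneg one_half_pos.le (surfInt_nonneg fun x => by positivity)
  · have hF' : m.snd F = none := by simpa [intFaces] using hF
    refine surfInt_nonneg fun x => mul_nonneg (abs_nonneg _) ?_
    simp [outer, hF']

end Divergence

end Mesh

/-! ### Broken constants without jumps -/

section Translate

variable {d : ℕ}

lemma bump_translate_eq_zero {U : Set (E d)} (hU : Convex ℝ U) {η : ContDiffBump (0 : E d)}
    {x y : E d} (hx : Metric.closedBall x η.rOut ⊆ U) (hy : Metric.closedBall y η.rOut ⊆ U)
    {s : ℝ} (hs : s ∈ Icc (0 : ℝ) 1) {z : E d} (hz : z ∉ U) : η (z - (x + s • (y - x))) = 0 := by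
  set v := z - (x + s • (y - x)) with hv
  refine η.zero_of_le_dist ?_
  by_contra! hlt
  rw [dist_zero_right] at hlt
  have hmem := hU.add_smul_sub_mem (hx (by simpa using hlt.le : x + v ∈ _))
    (hy (by simpa using hlt.le : y + v ∈ _)) hs
  have hz' : x + v + s • (y + v - (x + v)) = z := by
    rw [add_sub_add_right_eq_sub, hv]
    abel
  exact hz (hz' ▸ hmem)

lemma integrable_fderiv_translate {A : Set (E d)} (hA : IsCompact A) {η : E d → ℝ}
    (hη : ContDiff ℝ 1 η) (x e : E d) :
    Integrable (Function.uncurry fun (s : ℝ) y => -fderiv ℝ η (y - (x + s • e)) e)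
      ((volume.restrict (Ioc (0 : ℝ) 1)).prod (volume.restrict A)) := by
  have := hη.continuous_fderiv one_ne_zero
  have hc : Continuous (Function.uncurry fun (s : ℝ) y => -fderiv ℝ η (y - (x + s • e)) e) := by
    unfold Function.uncurry
    fun_prop
  rw [Measure.prod_restrict]
  exact (hc.continuousOn.integrableOn_compact (isCompact_Icc.prod hA)).mono_set
    (prod_mono_left Ioc_subset_Icc_self)

lemma setIntegral_translate_sub {A : Set (E d)} (hA : IsCompact A) {η : E d → ℝ}
    (hη : ContDiff ℝ 1 η) (x e : E d) :
    (∫ y in A, η (y - (x + e))) - ∫ y in A, η (y - x) =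
      ∫ s in (0 : ℝ)..1, ∫ y in A, -fderiv ℝ η (y - (x + s • e)) e := by
  have := hη.continuous_fderiv one_ne_zero
  have := hη.continuous
  have hline : ∀ y, η (y - (x + e)) - η (y - x) =
      ∫ s in (0 : ℝ)..1, -fderiv ℝ η (y - (x + s • e)) e := by
    intro y
    rw [intervalIntegral.integral_eq_sub_of_hasDerivAt (f := fun s : ℝ => η (y - (x + s • e)))]
    · simp
    · intro s _
      have hpath : HasDerivAt (fun s : ℝ => y - (x + s • e)) (-e) s := by
        simpa using (((hasDerivAt_id s).smul_const e).const_add x).const_sub y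
      simpa only [Function.comp_def, map_neg] using
        (hη.differentiable one_ne_zero (y - (x + s • e))).hasFDerivAt.comp_hasDerivAt s hpath
    · exact Continuous.intervalIntegrable (by fun_prop) _ _
  have hint : ∀ c, IntegrableOn (fun y => η (y - c)) A := fun c =>
    integrableOn_of_isCompact hA hA.measure_lt_top (by fun_prop)
  rw [intervalIntegral.integral_of_le zero_le_one,
    integral_integral_swap (integrable_fderiv_translate hA hη x e),
    ← integral_sub (hint _) (hint _)]
  simp only [hline, intervalIntegral.integral_of_le zero_le_one]

end Translate

namespace Mesh

section Connected

variable {d : ℕ} {O : Set (E d)} (m : Mesh O)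

lemma disjoint_interior_cell {K L : m.Cell} (h : K ≠ L) :
    Disjoint (interior (m.cell K)) (m.cell L) := by
  have hcl := (m.disjoint K L h).closure_right isOpen_interior
  rw [(m.cell_polytope L).convex.closure_interior_eq_closure_of_nonempty_interior
    (m.cell_interior L)] at hcl
  exact hcl.mono_right subset_closure

lemma inter_interior_cell_nonempty {U : Set (E d)} (hU : IsOpen U) {K : m.Cell}
    (h : (U ∩ m.cell K).Nonempty) : (U ∩ interior (m.cell K)).Nonempty := by
  obtain ⟨x, hxU, hxK⟩ := h
  refine mem_closure_iff.1 ?_ U hU hxU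
  rw [(m.cell_polytope K).convex.closure_interior_eq_closure_of_nonempty_interior
    (m.cell_interior K)]
  exact subset_closure hxK

lemma sum_mul_setIntegral_bump {K : m.Cell} {x : E d} {η : ContDiffBump (0 : E d)}
    (hball : Metric.closedBall x η.rOut ⊆ interior (m.cell K)) (g : m.Cell → ℝ) :
    ∑ L, g L * ∫ y in m.cell L, η (y - x) = g K * ∫ y, η y := by
  have hzero : ∀ y, y ∉ interior (m.cell K) → η (y - x) = 0 := by
    intro y hy
    refine η.zero_of_le_dist ?_
    rw [dist_zero_right, ← dist_eq_norm]
    by_contra! h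
    exact hy (hball (Metric.mem_closedBall.2 h.le))
  rw [Finset.sum_eq_single K]
  · rw [setIntegral_eq_integral_of_forall_compl_eq_zero fun y hy =>
      hzero y fun h => hy (interior_subset h), integral_sub_right_eq_self fun y => η y]
  · intro L _ hL
    rw [setIntegral_eq_zero_of_forall_eq_zero fun y hy => hzero y fun h =>
      (m.disjoint_interior_cell hL.symm).notMem_of_mem_left h hy, mul_zero]
  · simp

variable {g : m.Cell → ℝ}

lemma sum_mul_setIntegral_fderiv_eq_zero (hd : 2 ≤ d)
    (hg : ∀ F K, m.snd F = some K → g (m.fst F) = g K) {η : E d → ℝ} (hη : ContDiff ℝ 1 η)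
    (hη₀ : ∀ z ∈ frontier O, η z = 0) (v : E d) :
    ∑ K, g K * ∫ z in m.cell K, fderiv ℝ η z v = 0 := by
  have hcell : ∀ K, g K * ∫ z in m.cell K, fderiv ℝ η z v =
      ∫ z in m.cell K, fderiv ℝ (fun z => g K * η z) z v := by
    intro K
    rw [← integral_const_mul]
    congr 1 with z
    rw [fderiv_const_mul (hη.differentiable one_ne_zero z)]
    rfl
  simp only [hcell]
  rw [m.sum_setIntegral_fderiv hd (fun K => contDiff_const.mul hη) v]
  refine Finset.sum_eq_zero fun F _ => ?_
  have hface : surfInt (m.face F) (m.jump (fun K z => g K * η z) F) = 0 := by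
    refine setIntegral_eq_zero_of_forall_eq_zero fun z hz => ?_
    unfold jump outer
    cases h : m.snd F with
    | none => simp [hη₀ z (m.boundary F h hz)]
    | some K => simp [hg F K h]
  rw [hface, mul_zero]

lemma sum_mul_setIntegral_translate (hd : 2 ≤ d)
    (hg : ∀ F K, m.snd F = some K → g (m.fst F) = g K) {η : E d → ℝ} (hη : ContDiff ℝ 1 η)
    {x e : E d} (hη₀ : ∀ s ∈ Icc (0 : ℝ) 1, ∀ z ∈ frontier O, η (z - (x + s • e)) = 0) :
    ∑ K, g K * ∫ z in m.cell K, η (z - (x + e)) = ∑ K, g K * ∫ z in m.cell K, η (z - x) := by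
  rw [← sub_eq_zero, ← Finset.sum_sub_distrib]
  simp only [← mul_sub, setIntegral_translate_sub (m.isCompact_cell _) hη x e,
    ← intervalIntegral.integral_const_mul]
  rw [← intervalIntegral.integral_finsetSum]
  · refine intervalIntegral.integral_zero_ae (ae_of_all _ fun s hs => ?_)
    rw [uIoc_of_le zero_le_one] at hs
    have hflux := m.sum_mul_setIntegral_fderiv_eq_zero hd hg
      (hη.comp (contDiff_id.sub contDiff_const)) (hη₀ s (Ioc_subset_Icc_self hs)) e
    simpa only [integral_neg, mul_neg, Finset.sum_neg_distrib, neg_eq_zero, Function.comp_def,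
      id_eq, fderiv_comp_sub] using hflux
  · intro K _
    rw [intervalIntegrable_iff_integrableOn_Ioc_of_le zero_le_one]
    exact (integrable_fderiv_translate (m.isCompact_cell K) hη x e).integral_prod_left.const_mul _

/-- The divergence theorem shows that `∑ K, g K * ∫ z in cell K, η (z - x)` does not change when
the bump `η` is moved from one cell to the other, inside `U` and thus away from `frontier O`. -/
lemma eq_of_convex (hd : 2 ≤ d) (hg : ∀ F K, m.snd F = some K → g (m.fst F) = g K)
    {U : Set (E d)} (hU : Convex ℝ U) (hUo : IsOpen U) (hUO : Disjoint U (frontier O))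
    {K L : m.Cell} (hK : (U ∩ m.cell K).Nonempty) (hL : (U ∩ m.cell L).Nonempty) : g K = g L := by
  have hball : ∀ {J}, (U ∩ m.cell J).Nonempty →
      ∃ x : E d, ∃ R > 0, Metric.closedBall x R ⊆ U ∩ interior (m.cell J) := fun hJ =>
    (m.inter_interior_cell_nonempty hUo hJ).imp fun x hx =>
      Metric.nhds_basis_closedBall.mem_iff.1 ((hUo.inter isOpen_interior).mem_nhds hx)
  obtain ⟨x, R₁, hR₁, hx⟩ := hball hK
  obtain ⟨y, R₂, hR₂, hy⟩ := hball hL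
  have hR : 0 < min R₁ R₂ := lt_min hR₁ hR₂
  let η : ContDiffBump (0 : E d) := ⟨min R₁ R₂ / 2, min R₁ R₂, half_pos hR, half_lt_self hR⟩
  replace hx : Metric.closedBall x η.rOut ⊆ U ∩ interior (m.cell K) :=
    (Metric.closedBall_subset_closedBall (min_le_left _ _)).trans hx
  replace hy : Metric.closedBall y η.rOut ⊆ U ∩ interior (m.cell L) :=
    (Metric.closedBall_subset_closedBall (min_le_right _ _)).trans hy
  have hmove := m.sum_mul_setIntegral_translate hd hg η.contDiff (x := x) (e := y - x)
    fun s hs z hz => bump_translate_eq_zero hU (hx.trans inter_subset_left)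
      (hy.trans inter_subset_left) hs (hUO.notMem_of_mem_right hz)
  rw [add_sub_cancel, m.sum_mul_setIntegral_bump (hx.trans inter_subset_right),
    m.sum_mul_setIntegral_bump (hy.trans inter_subset_right)] at hmove
  exact (mul_right_cancel₀ (η.integral_pos (μ := volume)).ne' hmove).symm

lemma eq_of_forall_jump_eq_zero (hd : 2 ≤ d) (hO : IsOpen O) (hO' : IsPreconnected O)
    (hg : ∀ F K, m.snd F = some K → g (m.fst F) = g K) (K L : m.Cell) : g K = g L := by
  have hmeet : ∀ J, (O ∩ m.cell J).Nonempty := by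
    intro J
    obtain ⟨x, hx⟩ := m.cell_interior J
    obtain ⟨y, hyJ, hyO⟩ := mem_closure_iff.1
      (m.cover ▸ mem_iUnion_of_mem J (interior_subset hx) : x ∈ closure O) _ isOpen_interior hx
    exact ⟨y, hyO, interior_subset hyJ⟩
  have hcover : ∀ y ∈ O, ∃ J, y ∈ m.cell J := fun y hy =>
    mem_iUnion.1 (m.cover ▸ subset_closure hy)
  obtain ⟨x, hxO, hxK⟩ := hmeet K
  obtain ⟨y, hyO, hyL⟩ := hmeet L
  refine hO'.induction₂ (fun x y => ∀ K L, x ∈ m.cell K → y ∈ m.cell L → g K = g L)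
    ?_ ?_ ?_ hxO hyO K L hxK hyL
  · intro x hx
    obtain ⟨R, hR, hball⟩ := Metric.isOpen_iff.1 hO x hx
    filter_upwards [mem_nhdsWithin_of_mem_nhds (Metric.ball_mem_nhds x hR)] with y hy K L hxK hyL
    exact m.eq_of_convex hd hg (convex_ball x R) Metric.isOpen_ball
      ((disjoint_frontier_iff_isOpen.2 hO).symm.mono_left hball)
      ⟨x, Metric.mem_ball_self hR, hxK⟩ ⟨y, hy, hyL⟩
  · intro x y z _ hy _ hxy hyz K L hxK hzL
    obtain ⟨J, hJ⟩ := hcover y hy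
    exact (hxy K J hxK hJ).trans (hyz J L hJ hzL)
  · exact fun x y _ _ hxy K L hyK hxL => (hxy L K hxL hyK).symm

end Connected

end Mesh

/-! ### Linearity and bilinearity of parametrised expressions -/

section Linearity

variable {X Y Z Z' ι α : Type*} [AddCommGroup X] [Module ℝ X] [AddCommGroup Y] [Module ℝ Y]
  [AddCommGroup Z] [Module ℝ Z] [AddCommGroup Z'] [Module ℝ Z'] [MeasurableSpace α]
  {μ : Measure α}

lemma isLinearMap_zero : IsLinearMap ℝ fun _ : X => (0 : Z) :=
  (0 : X →ₗ[ℝ] Z).isLinear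

lemma isLinearMap_comp {T : X → Z} (hT : IsLinearMap ℝ T) (L : Z →ₗ[ℝ] Z') :
    IsLinearMap ℝ fun u => L (T u) :=
  (L ∘ₗ hT.mk' T).isLinear

lemma isLinearMap_add {T T' : X → Z} (hT : IsLinearMap ℝ T) (hT' : IsLinearMap ℝ T') :
    IsLinearMap ℝ fun u => T u + T' u :=
  (hT.mk' T + hT'.mk' T').isLinear

lemma isLinearMap_sub {T T' : X → Z} (hT : IsLinearMap ℝ T) (hT' : IsLinearMap ℝ T') :
    IsLinearMap ℝ fun u => T u - T' u :=
  (hT.mk' T - hT'.mk' T').isLinear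

lemma isLinearMap_const_smul {T : X → Z} (hT : IsLinearMap ℝ T) (c : ℝ) :
    IsLinearMap ℝ fun u => c • T u :=
  (c • hT.mk' T).isLinear

lemma isLinearMap_const_mul {T : X → ℝ} (hT : IsLinearMap ℝ T) (c : ℝ) :
    IsLinearMap ℝ fun u => c * T u :=
  isLinearMap_const_smul hT c

lemma isLinearMap_sum {s : Finset ι} {T : ι → X → Z} (hT : ∀ i, IsLinearMap ℝ (T i)) :
    IsLinearMap ℝ fun u => ∑ i ∈ s, T i u where
  map_add u u' := by simp only [(hT _).map_add, Finset.sum_add_distrib]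
  map_smul c u := by simp only [(hT _).map_smul, Finset.smul_sum]

lemma isLinearMap_integral {T : X → α → ℝ} (hT : ∀ a, IsLinearMap ℝ fun u => T u a)
    (hi : ∀ u, Integrable (T u) μ) : IsLinearMap ℝ fun u => ∫ a, T u a ∂μ where
  map_add u u' := by simp only [(hT _).map_add, integral_add (hi u) (hi u')]
  map_smul c u := by simp only [(hT _).map_smul, integral_smul]

lemma isBilinearMap_of {f : X → Y → Z} (left : ∀ w, IsLinearMap ℝ fun u => f u w)
    (right : ∀ u, IsLinearMap ℝ (f u)) : IsBilinearMap ℝ f where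
  add_left u u' w := (left w).map_add u u'
  smul_left c u w := (left w).map_smul c u
  add_right u := (right u).map_add
  smul_right c u := (right u).map_smul c

lemma isLinearMap_left {f : X → Y → Z} (hf : IsBilinearMap ℝ f) (w : Y) :
    IsLinearMap ℝ fun u => f u w :=
  (hf.toLinearMap.flip w).isLinear

lemma isLinearMap_right {f : X → Y → Z} (hf : IsBilinearMap ℝ f) (u : X) :
    IsLinearMap ℝ (f u) :=
  (hf.toLinearMap u).isLinear

lemma isBilinearMap_swap {f : X → Y → Z} (hf : IsBilinearMap ℝ f) :
    IsBilinearMap ℝ fun w u => f u w :=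
  isBilinearMap_of (isLinearMap_right hf) (isLinearMap_left hf)

lemma isBilinearMap_comp {T : X → Z} {T' : Y → Z'} (hT : IsLinearMap ℝ T)
    (hT' : IsLinearMap ℝ T') (B : Z →ₗ[ℝ] Z' →ₗ[ℝ] ℝ) :
    IsBilinearMap ℝ fun u w => B (T u) (T' w) :=
  isBilinearMap_of (fun w => isLinearMap_comp hT (B.flip (T' w)))
    fun u => isLinearMap_comp hT' (B (T u))

lemma isBilinearMap_inner {H : Type*} [NormedAddCommGroup H] [InnerProductSpace ℝ H] {T : X → H}
    {T' : Y → H} (hT : IsLinearMap ℝ T) (hT' : IsLinearMap ℝ T') :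
    IsBilinearMap ℝ fun u w => ⟪T u, T' w⟫ :=
  isBilinearMap_comp hT hT' (innerₗ H)

lemma isBilinearMap_mul {T : X → ℝ} {T' : Y → ℝ} (hT : IsLinearMap ℝ T)
    (hT' : IsLinearMap ℝ T') : IsBilinearMap ℝ fun u w => T u * T' w :=
  isBilinearMap_comp hT hT' (LinearMap.mul ℝ ℝ)

lemma isBilinearMap_add {f f' : X → Y → Z} (hf : IsBilinearMap ℝ f) (hf' : IsBilinearMap ℝ f') :
    IsBilinearMap ℝ fun u w => f u w + f' u w :=
  isBilinearMap_of (fun w => isLinearMap_add (isLinearMap_left hf w) (isLinearMap_left hf' w))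
    fun u => isLinearMap_add (isLinearMap_right hf u) (isLinearMap_right hf' u)

lemma isBilinearMap_sub {f f' : X → Y → Z} (hf : IsBilinearMap ℝ f) (hf' : IsBilinearMap ℝ f') :
    IsBilinearMap ℝ fun u w => f u w - f' u w :=
  isBilinearMap_of (fun w => isLinearMap_sub (isLinearMap_left hf w) (isLinearMap_left hf' w))
    fun u => isLinearMap_sub (isLinearMap_right hf u) (isLinearMap_right hf' u)

lemma isBilinearMap_const_mul {f : X → Y → ℝ} (hf : IsBilinearMap ℝ f) (c : ℝ) :
    IsBilinearMap ℝ fun u w => c * f u w :=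
  isBilinearMap_of (fun w => isLinearMap_const_mul (isLinearMap_left hf w) c)
    fun u => isLinearMap_const_mul (isLinearMap_right hf u) c

lemma isBilinearMap_sum {s : Finset ι} {f : ι → X → Y → Z} (hf : ∀ i, IsBilinearMap ℝ (f i)) :
    IsBilinearMap ℝ fun u w => ∑ i ∈ s, f i u w :=
  isBilinearMap_of (fun w => isLinearMap_sum fun i => isLinearMap_left (hf i) w)
    fun u => isLinearMap_sum fun i => isLinearMap_right (hf i) u

lemma isBilinearMap_integral {f : X → Y → α → ℝ} (hf : ∀ a, IsBilinearMap ℝ fun u w => f u w a)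
    (hi : ∀ u w, Integrable (f u w) μ) : IsBilinearMap ℝ fun u w => ∫ a, f u w a ∂μ :=
  isBilinearMap_of
    (fun w => isLinearMap_integral (fun a => isLinearMap_left (hf a) w) fun u => hi u w)
    fun u => isLinearMap_integral (fun a => isLinearMap_right (hf a) u) (hi u)

lemma existsUnique_isBilinearMap_eq [FiniteDimensional ℝ X] {B : X → X → ℝ}
    (hB : IsBilinearMap ℝ B) (h0 : ∀ u, B u u = 0 → u = 0) {l : X → ℝ} (hl : IsLinearMap ℝ l) :
    ∃! u, ∀ w, B u w = l w :=
  existsUnique_riesz (B := hB.toLinearMap) h0 (hl.mk' l)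

end Linearity

namespace Mesh

variable {d : ℕ} {O : Set (E d)} {m : Mesh O} {r r' : ℕ}

section Traces

variable {X Y V : Type*} [AddCommGroup X] [Module ℝ X] [AddCommGroup Y] [Module ℝ Y]
  [AddCommGroup V] [Module ℝ V]

lemma isLinearMap_outer {Φ : X → m.Cell → E d → V} (hΦ : ∀ K x, IsLinearMap ℝ fun u => Φ u K x)
    (F : m.Face) (x : E d) : IsLinearMap ℝ fun u => m.outer (Φ u) F x := by
  unfold outer
  cases m.snd F with
  | none => exact isLinearMap_zero
  | some K => exact hΦ K x

lemma isLinearMap_jump {Φ : X → m.Cell → E d → V} (hΦ : ∀ K x, IsLinearMap ℝ fun u => Φ u K x)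
    (F : m.Face) (x : E d) : IsLinearMap ℝ fun u => m.jump (Φ u) F x :=
  isLinearMap_sub (hΦ _ x) (isLinearMap_outer hΦ F x)

lemma isLinearMap_avg {Φ : X → m.Cell → E d → V} (hΦ : ∀ K x, IsLinearMap ℝ fun u => Φ u K x)
    (F : m.Face) (x : E d) : IsLinearMap ℝ fun u => m.avg (Φ u) F x := by
  unfold avg
  cases m.snd F with
  | none => exact hΦ _ x
  | some K => exact isLinearMap_const_smul (isLinearMap_add (hΦ _ x) (hΦ K x)) _

lemma isBilinearMap_avg {Φ : X → Y → m.Cell → E d → V}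
    (hΦ : ∀ K x, IsBilinearMap ℝ fun u w => Φ u w K x) (F : m.Face) (x : E d) :
    IsBilinearMap ℝ fun u w => m.avg (Φ u w) F x :=
  isBilinearMap_of (fun w => isLinearMap_avg (fun K x => isLinearMap_left (hΦ K x) w) F x)
    fun u => isLinearMap_avg (fun K x => isLinearMap_right (hΦ K x) u) F x

end Traces

/-! ### Bilinearity of the discrete forms -/

lemma isLinearMap_eval {V : Type*} [AddCommGroup V] [Module ℝ V]
    (U : Submodule ℝ (m.Cell → E d → V)) (K : m.Cell) (x : E d) :
    IsLinearMap ℝ fun w : U => (w : m.Cell → E d → V) K x :=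
  ⟨fun _ _ => rfl, fun _ _ => rfl⟩

lemma isLinearMap_jac (K : m.Cell) (x : E d) :
    IsLinearMap ℝ fun w : m.Mh r => m.jac w K x where
  map_add u u' := fderiv_add (differentiable_of_mem_Mh u.2 K x) (differentiable_of_mem_Mh u'.2 K x)
  map_smul c u := fderiv_const_smul (differentiable_of_mem_Mh u.2 K x) c

lemma isLinearMap_grad (K : m.Cell) (x : E d) :
    IsLinearMap ℝ fun g : m.Ph r => m.grad g K x := by
  have hg : ∀ g : m.Ph r, DifferentiableAt ℝ (g.1 K) x := fun g =>
    (contDiff_of_mem_Ph g.2 K).differentiable one_ne_zero x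
  have hfderiv : IsLinearMap ℝ fun g : m.Ph r => fderiv ℝ (g.1 K) x :=
    ⟨fun g g' => fderiv_add (hg g) (hg g'), fun c g => fderiv_const_smul (hg g) c⟩
  exact isLinearMap_comp hfderiv (InnerProductSpace.toDual ℝ (E d)).symm.toLinearEquiv.toLinearMap

lemma isLinearMap_jac_apply (K : m.Cell) (x v : E d) :
    IsLinearMap ℝ fun w : m.Mh r => m.jac w K x v :=
  isLinearMap_comp (isLinearMap_jac K x) (ContinuousLinearMap.apply ℝ (E d) v).toLinearMap

lemma isLinearMap_avg_jac_apply (F : m.Face) (x v : E d) :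
    IsLinearMap ℝ fun w : m.Mh r => m.avg (m.jac w) F x v :=
  isLinearMap_comp (isLinearMap_avg isLinearMap_jac F x)
    (ContinuousLinearMap.apply ℝ (E d) v).toLinearMap

lemma isLinearMap_div (K : m.Cell) (x : E d) :
    IsLinearMap ℝ fun w : m.Mh r => div (w.1 K) x :=
  isLinearMap_sum fun j => isLinearMap_comp (isLinearMap_jac_apply K x _)
    (EuclideanSpace.proj j : E d →L[ℝ] ℝ).toLinearMap

lemma isBilinearMap_innerVec :
    IsBilinearMap ℝ fun (u : m.Mh r) (w : m.Mh r') => m.innerVec u w :=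
  isBilinearMap_sum fun K => isBilinearMap_integral
    (fun x => isBilinearMap_inner (isLinearMap_eval _ K x) (isLinearMap_eval _ K x))
    fun u w => m.integrableOn_cell K
      ((continuous_of_mem_Mh u.2 K).inner (continuous_of_mem_Mh w.2 K))

lemma isBilinearMap_innerScal :
    IsBilinearMap ℝ fun (p : m.Ph r) (g : m.Ph r') => m.innerScal p g :=
  isBilinearMap_sum fun K => isBilinearMap_integral
    (fun x => isBilinearMap_mul (isLinearMap_eval _ K x) (isLinearMap_eval _ K x))
    fun p g => m.integrableOn_cell K
      ((continuous_of_mem_Ph p.2 K).mul (continuous_of_mem_Ph g.2 K))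

lemma isBilinearMap_b : IsBilinearMap ℝ fun (w : m.Mh r) (g : m.Ph r') => m.b w g := by
  refine isBilinearMap_sub (isBilinearMap_sum fun K => ?_) (isBilinearMap_sum fun F => ?_)
  · exact isBilinearMap_integral
      (fun x => isBilinearMap_mul (isLinearMap_div K x) (isLinearMap_eval _ K x))
      fun w g => m.integrableOn_cell K ((continuous_div w.2 K).mul (continuous_of_mem_Ph g.2 K))
  · refine isBilinearMap_integral (fun x => isBilinearMap_swap (isBilinearMap_mul
      (isLinearMap_avg (isLinearMap_eval _) F x)
      (isLinearMap_comp (isLinearMap_jump (isLinearMap_eval _) F x) (innerₗ (E d) (m.normal F)))))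
      fun w g => m.integrableOn_face F ?_
    exact (m.continuous_avg (continuous_of_mem_Ph g.2) F).mul
      (continuous_const.inner (m.continuous_jump (continuous_of_mem_Mh w.2) F))

lemma isBilinearMap_jac_jump : IsBilinearMap ℝ fun (u : m.Mh r) (w : m.Mh r') =>
    ∑ F, surfInt (m.face F) fun x =>
      ⟪m.avg (m.jac u) F x (m.normal F), m.jump (w : m.Vec) F x⟫ := by
  refine isBilinearMap_sum fun F => isBilinearMap_integral (fun x => isBilinearMap_inner
    (isLinearMap_avg_jac_apply F x _) (isLinearMap_jump (isLinearMap_eval _) F x))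
    fun u w => m.integrableOn_face F ?_
  exact ((m.continuous_avg (continuous_jac u.2) F).clm_apply continuous_const).inner
    (m.continuous_jump (continuous_of_mem_Mh w.2) F)

lemma isBilinearMap_Aeps (ε σ : ℝ) :
    IsBilinearMap ℝ fun (u : m.Mh r) (w : m.Mh r') => m.Aeps ε σ u w := by
  refine isBilinearMap_add (isBilinearMap_add (isBilinearMap_sub ?_ isBilinearMap_jac_jump)
    (isBilinearMap_const_mul (isBilinearMap_swap isBilinearMap_jac_jump) ε)) ?_
  · refine isBilinearMap_sum fun K => isBilinearMap_integral (fun x => isBilinearMap_sum fun j =>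
      isBilinearMap_inner (isLinearMap_jac_apply K x _) (isLinearMap_jac_apply K x _))
      fun u w => m.integrableOn_cell K ?_
    exact continuous_finsetSum _ fun j _ =>
      ((continuous_jac u.2 K).clm_apply continuous_const).inner
        ((continuous_jac w.2 K).clm_apply continuous_const)
  · refine isBilinearMap_sum fun F => isBilinearMap_const_mul (isBilinearMap_integral
      (fun x => isBilinearMap_inner (isLinearMap_jump (isLinearMap_eval _) F x)
        (isLinearMap_jump (isLinearMap_eval _) F x)) fun u w => m.integrableOn_face F ?_) _
    exact (m.continuous_jump (continuous_of_mem_Mh u.2) F).inner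
      (m.continuous_jump (continuous_of_mem_Mh w.2) F)

lemma isBilinearMap_grad_jump : IsBilinearMap ℝ fun (v : m.Ph r) (g : m.Ph r') =>
    ∑ F ∈ m.intFaces, surfInt (m.face F) fun x =>
      ⟪m.avg (m.grad v) F x, m.normal F⟫ * m.jump (g : m.Scal) F x := by
  refine isBilinearMap_sum fun F => isBilinearMap_integral (fun x => isBilinearMap_mul
    (isLinearMap_comp (isLinearMap_avg isLinearMap_grad F x) ((innerₗ (E d)).flip (m.normal F)))
    (isLinearMap_jump (isLinearMap_eval _) F x)) fun v g => m.integrableOn_face F ?_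
  exact ((m.continuous_avg (continuous_grad v.2) F).inner continuous_const).mul
    (m.continuous_jump (continuous_of_mem_Ph g.2) F)

lemma isBilinearMap_Asip (σ : ℝ) :
    IsBilinearMap ℝ fun (v : m.Ph r) (g : m.Ph r') => m.Asip σ v g := by
  refine isBilinearMap_add (isBilinearMap_sub (isBilinearMap_sub ?_ isBilinearMap_grad_jump)
    (isBilinearMap_swap isBilinearMap_grad_jump)) ?_
  · exact isBilinearMap_sum fun K => isBilinearMap_integral
      (fun x => isBilinearMap_inner (isLinearMap_grad K x) (isLinearMap_grad K x))
      fun v g => m.integrableOn_cell K ((continuous_grad v.2 K).inner (continuous_grad g.2 K))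
  · refine isBilinearMap_sum fun F => isBilinearMap_const_mul (isBilinearMap_integral
      (fun x => isBilinearMap_mul (isLinearMap_jump (isLinearMap_eval _) F x)
        (isLinearMap_jump (isLinearMap_eval _) F x)) fun v g => m.integrableOn_face F ?_) _
    exact (m.continuous_jump (continuous_of_mem_Ph v.2) F).mul
      (m.continuous_jump (continuous_of_mem_Ph g.2) F)

lemma isBilinearMap_Ac_cell {z : m.Vec} (hz : z ∈ m.Mh r) (K : m.Cell) :
    IsBilinearMap ℝ fun (φ w : m.Mh r') =>
      (∫ x in m.cell K, ⟪fderiv ℝ (φ.1 K) x (z K x), w.1 K x⟫)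
        + (1 / 2) * ∫ x in m.cell K, div (z K) x * ⟪φ.1 K x, w.1 K x⟫ := by
  refine isBilinearMap_add (isBilinearMap_integral (fun x => isBilinearMap_inner
    (isLinearMap_jac_apply K x _) (isLinearMap_eval _ K x)) fun φ w => m.integrableOn_cell K ?_)
    (isBilinearMap_const_mul (isBilinearMap_integral (fun x => isBilinearMap_const_mul
      (isBilinearMap_inner (isLinearMap_eval _ K x) (isLinearMap_eval _ K x)) _)
      fun φ w => m.integrableOn_cell K ?_) _)
  · exact ((continuous_jac φ.2 K).clm_apply (continuous_of_mem_Mh hz K)).inner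
      (continuous_of_mem_Mh w.2 K)
  · exact (continuous_div hz K).mul
      ((continuous_of_mem_Mh φ.2 K).inner (continuous_of_mem_Mh w.2 K))

lemma isBilinearMap_Ac (θ : m.Vec) {z : m.Vec} (hz : z ∈ m.Mh r) :
    IsBilinearMap ℝ fun (φ w : m.Mh r') => m.Ac θ z φ w := by
  have hzc := continuous_of_mem_Mh hz
  have hinflow : ∀ F s, m.inflow θ F s ⊆ m.face F := fun F s => sep_subset _ _
  refine isBilinearMap_add (isBilinearMap_add (isBilinearMap_sub
    (isBilinearMap_sum (isBilinearMap_Ac_cell hz))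
    (isBilinearMap_const_mul (isBilinearMap_sum fun F => ?_) _))
    (isBilinearMap_sum fun F => ?_)) (isBilinearMap_sum fun F => ?_)
  · refine isBilinearMap_integral (fun x => isBilinearMap_const_mul (isBilinearMap_avg
      (fun K y => isBilinearMap_inner (isLinearMap_eval _ K y) (isLinearMap_eval _ K y)) F x) _)
      fun φ w => m.integrableOn_face F ?_
    exact ((m.continuous_jump hzc F).inner continuous_const).mul (m.continuous_avg (fun K =>
      (continuous_of_mem_Mh φ.2 K).inner (continuous_of_mem_Mh w.2 K)) F)
  · refine isBilinearMap_integral (fun x => isBilinearMap_const_mul (isBilinearMap_inner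
      (isLinearMap_jump (isLinearMap_eval _) F x) (isLinearMap_eval _ _ x)) _)
      fun φ w => (m.integrableOn_face F ?_).mono_set (hinflow F 1)
    exact ((m.continuous_avg hzc F).inner continuous_const).abs.mul
      ((m.continuous_jump (continuous_of_mem_Mh φ.2) F).inner (continuous_of_mem_Mh w.2 _))
  · refine isBilinearMap_integral (fun x => isBilinearMap_const_mul (isBilinearMap_inner
      (isLinearMap_sub (isLinearMap_outer (isLinearMap_eval _) F x) (isLinearMap_eval _ _ x))
      (isLinearMap_outer (isLinearMap_eval _) F x)) _)
      fun φ w => (m.integrableOn_face F ?_).mono_set (hinflow F (-1))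
    exact ((m.continuous_avg hzc F).inner continuous_const).abs.mul
      (((m.continuous_outer (continuous_of_mem_Mh φ.2) F).sub
        (continuous_of_mem_Mh φ.2 _)).inner (m.continuous_outer (continuous_of_mem_Mh w.2) F))

end Mesh

/-! ### Definiteness -/

namespace Mesh

section Definiteness

variable {d : ℕ} {O : Set (E d)} {m : Mesh O} {r : ℕ}

instance finiteDimensional_Ph : FiniteDimensional ℝ (m.Ph r) := by
  let Φ : m.Ph r →ₗ[ℝ] m.Cell → polyFun d r :=
    { toFun := fun g K => ⟨g.1 K, g.2 K⟩
      map_add' := fun _ _ => rfl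
      map_smul' := fun _ _ => rfl }
  refine Module.Finite.of_injective Φ fun g g' h => ?_
  ext K x
  exact congrFun (congrArg Subtype.val (congrFun h K)) x

instance finiteDimensional_Mh : FiniteDimensional ℝ (m.Mh r) := by
  let Φ : m.Mh r →ₗ[ℝ] m.Cell → Fin d → polyFun d r :=
    { toFun := fun w K i => ⟨fun x => w.1 K x i, w.2 K i⟩
      map_add' := fun _ _ => rfl
      map_smul' := fun _ _ => rfl }
  refine Module.Finite.of_injective Φ fun w w' h => ?_
  ext K x i
  exact congrFun (congrArg Subtype.val (congrFun (congrFun h K) i)) x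

lemma eq_zero_of_sum_setIntegral {f : m.Scal} (hf : ∀ K, Continuous (f K))
    (h0 : ∀ K x, 0 ≤ f K x) (h : ∑ K, ∫ x in m.cell K, f K x = 0) (K : m.Cell) {x : E d}
    (hx : x ∈ interior (m.cell K)) : f K x = 0 := by
  have hK := (Finset.sum_eq_zero_iff_of_nonneg fun K _ => integral_nonneg (h0 K)).1 h K
    (Finset.mem_univ K)
  exact eq_zero_of_setIntegral_eq_zero (hf K) (fun x _ => h0 K x)
    (m.isCompact_cell K).measurableSet (m.integrableOn_cell K (hf K)) hK hx

lemma eq_zero_of_innerVec_self {w : m.Vec} (hw : w ∈ m.Mh r) (h : m.innerVec w w = 0) :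
    w = 0 := by
  have hzero := eq_zero_of_sum_setIntegral (f := fun K x => ⟪w K x, w K x⟫)
    (fun K => (continuous_of_mem_Mh hw K).inner (continuous_of_mem_Mh hw K))
    (fun K x => real_inner_self_nonneg) h
  ext K x i
  refine congrFun (eq_zero_of_mem_polyFun (hw K i) (m.cell_interior K) fun x hx => ?_) x
  rw [inner_self_eq_zero.1 (hzero K hx), PiLp.zero_apply]

lemma eq_zero_of_innerScal_self {g : m.Scal} (hg : g ∈ m.Ph r) (h : m.innerScal g g = 0) :
    g = 0 := by
  have hzero := eq_zero_of_sum_setIntegral (f := fun K x => g K x * g K x)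
    (fun K => (continuous_of_mem_Ph hg K).mul (continuous_of_mem_Ph hg K))
    (fun K x => mul_self_nonneg _) h
  ext K x
  exact congrFun (eq_zero_of_mem_polyFun (hg K) (m.cell_interior K)
    fun x hx => mul_self_eq_zero.1 (hzero K hx)) x

lemma apply_eq_apply_zero_of_grad {g : m.Scal} (hg : g ∈ m.Ph r)
    (h : ∑ K, ∫ x in m.cell K, ‖m.grad g K x‖ ^ 2 = 0) (K : m.Cell) (x : E d) :
    g K x = g K 0 := by
  have hgrad : ∀ y ∈ interior (m.cell K), ‖m.grad g K y‖ ^ 2 = 0 := fun y hy =>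
    eq_zero_of_sum_setIntegral (f := fun K x => ‖m.grad g K x‖ ^ 2)
      (fun K => (continuous_grad hg K).norm.pow 2) (fun K x => sq_nonneg _) h K hy
  have hfderiv : ∀ y, fderiv ℝ (g K) y = 0 := by
    intro y
    ext v
    refine congrFun (eq_zero_of_mem_polyFun (fderiv_apply_mem_polyFun (hg K) v)
      (m.cell_interior K) fun z hz => ?_) y
    have hz' : gradient (g K) z = 0 := norm_eq_zero.1 (sq_eq_zero_iff.1 (hgrad z hz))
    rw [← inner_gradient, hz', inner_zero_left]
  exact is_const_of_fderiv_eq_zero ((contDiff_of_mem_Ph hg K).differentiable one_ne_zero)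
    hfderiv x 0

lemma eq_across_face_of_jump (hd : 2 ≤ d) {σ : ℝ} (hσ : 0 < σ) {c : m.Cell → ℝ}
    (h : ∑ F ∈ m.intFaces, σ / m.hF F *
      surfInt (m.face F) (fun x => m.jump (fun K _ => c K) F x ^ 2) = 0)
    {F : m.Face} {K : m.Cell} (hF : m.snd F = some K) : c (m.fst F) = c K := by
  have hσF : ∀ F, 0 < σ / m.hF F := fun F => div_pos hσ (m.hF_pos hd F)
  have hterm := (Finset.sum_eq_zero_iff_of_nonneg fun F _ => mul_nonneg (hσF F).le
    (surfInt_nonneg fun x => sq_nonneg _)).1 h F (by simp [intFaces, hF])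
  have hjump : ∀ x : E d, m.jump (fun K _ => c K) F x = c (m.fst F) - c K := fun x => by
    simp only [jump, outer, hF, Option.elim_some]
  have hsurf := ENNReal.toReal_pos (m.surface_face_pos hd F).ne' (m.surface_face_lt_top F).ne
  simp only [surfInt, hjump, setIntegral_const, smul_eq_mul] at hterm
  exact sub_eq_zero.1 (sq_eq_zero_iff.1 ((mul_eq_zero.1
    ((mul_eq_zero.1 hterm).resolve_left (hσF F).ne')).resolve_left hsurf.ne'))

lemma eq_zero_of_sum_setIntegral_const {c : ℝ} (h : ∑ K, ∫ _ in m.cell K, c = 0) (K : m.Cell) :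
    c = 0 := by
  have hpos : ∀ L, 0 < volume.real (m.cell L) := fun L =>
    ENNReal.toReal_pos ((isOpen_interior.measure_pos volume (m.cell_interior L)).trans_le
      (measure_mono interior_subset)).ne' (m.isCompact_cell L).measure_lt_top.ne
  simp only [setIntegral_const, smul_eq_mul, ← Finset.sum_mul] at h
  exact (mul_eq_zero.1 h).resolve_left
    (Finset.sum_pos (fun L _ => hpos L) ⟨K, Finset.mem_univ K⟩).ne'

lemma eq_zero_of_normSqScal (hd : 2 ≤ d) (hO : IsOpen O) (hO' : IsPreconnected O) {σ : ℝ}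
    (hσ : 0 < σ) {g : m.Scal} (hg : g ∈ m.Ph0 r) (h : m.normSqScal σ g ≤ 0) : g = 0 := by
  unfold normSqScal at h
  have hgrad₀ : 0 ≤ ∑ K, ∫ x in m.cell K, ‖m.grad g K x‖ ^ 2 :=
    Finset.sum_nonneg fun K _ => integral_nonneg fun x => sq_nonneg _
  have hjump₀ : 0 ≤ ∑ F ∈ m.intFaces, σ / m.hF F * surfInt (m.face F) fun x => m.jump g F x ^ 2 :=
    Finset.sum_nonneg fun F _ => mul_nonneg (div_pos hσ (m.hF_pos hd F)).le
      (surfInt_nonneg fun x => sq_nonneg _)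
  have hgrad : ∑ K, ∫ x in m.cell K, ‖m.grad g K x‖ ^ 2 = 0 := by linarith
  have hjump : ∑ F ∈ m.intFaces,
      σ / m.hF F * surfInt (m.face F) (fun x => m.jump g F x ^ 2) = 0 := by linarith
  have hconst : g = fun K _ => g K 0 := by
    ext K x
    exact apply_eq_apply_zero_of_grad hg.1 hgrad K x
  rw [hconst] at hjump
  have heq := m.eq_of_forall_jump_eq_zero hd hO hO' (g := fun K => g K 0)
    fun F K => eq_across_face_of_jump hd hσ hjump
  ext K x
  have hmean := hg.2
  rw [hconst] at hmean
  simp only [heq _ K] at hmean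
  rw [hconst]
  exact eq_zero_of_sum_setIntegral_const hmean K

end Definiteness

section MeanZero

variable {d : ℕ} {O : Set (E d)} (m : Mesh O) (r : ℕ)

/-- `P_h⁰` as a subspace; it has the same elements as the set `Ph0`. -/
def Ph0Submodule : Submodule ℝ m.Scal where
  carrier := m.Ph0 r
  zero_mem' := ⟨(m.Ph r).zero_mem, by simp⟩
  add_mem' := by
    rintro g g' ⟨hg, h⟩ ⟨hg', h'⟩
    refine ⟨(m.Ph r).add_mem hg hg', ?_⟩
    have hadd : ∀ K, ∫ x in m.cell K, (g + g') K x =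
        (∫ x in m.cell K, g K x) + ∫ x in m.cell K, g' K x := fun K =>
      integral_add (m.integrableOn_cell K (continuous_of_mem_Ph hg K))
        (m.integrableOn_cell K (continuous_of_mem_Ph hg' K))
    simp only [hadd, Finset.sum_add_distrib, h, h', add_zero]
  smul_mem' := by
    rintro c g ⟨hg, h⟩
    refine ⟨(m.Ph r).smul_mem c hg, ?_⟩
    have hsmul : ∀ K, ∫ x in m.cell K, (c • g) K x = c * ∫ x in m.cell K, g K x := fun K =>
      integral_const_mul c _
    simp only [hsmul, ← Finset.mul_sum, h, mul_zero]

lemma Ph0Submodule_le : m.Ph0Submodule r ≤ m.Ph r := fun _ h => h.1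

instance finiteDimensional_Ph0Submodule : FiniteDimensional ℝ (m.Ph0Submodule r) :=
  Submodule.finiteDimensional_of_le (m.Ph0Submodule_le r)

end MeanZero

/-! ### The source term -/

section Source

variable {d : ℕ} {O : Set (E d)} {m : Mesh O} {r : ℕ} {f : E d → E d}

lemma integrableOn_cell_of_memLp (hO : volume (frontier O) = 0)
    (hf : MemLp f 2 (volume.restrict O)) (K : m.Cell) : IntegrableOn f (m.cell K) := by
  rw [← Measure.restrict_congr_set (closure_ae_eq_of_null_frontier hO)] at hf
  have : IsFiniteMeasure (volume.restrict (m.cell K)) :=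
    isFiniteMeasure_restrict.2 (m.isCompact_cell K).measure_lt_top.ne
  exact (hf.mono_measure (Measure.restrict_mono (m.cover ▸ subset_iUnion m.cell K)
    le_rfl)).integrable one_le_two

lemma isLinearMap_innerVec_left (hf : ∀ K, IntegrableOn f (m.cell K)) :
    IsLinearMap ℝ fun w : m.Mh r => m.innerVec (fun _ => f) w := by
  refine isLinearMap_sum fun K => isLinearMap_integral
    (fun x => isLinearMap_comp (isLinearMap_eval _ K x) (innerₗ (E d) (f x))) fun w => ?_
  have hw := continuous_of_mem_Mh w.2 K
  obtain ⟨C, hC⟩ := (m.isCompact_cell K).exists_bound_of_continuousOn hw.continuousOn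
  refine Integrable.mono' ((hf K).norm.mul_const C)
    ((hf K).aestronglyMeasurable.inner hw.aestronglyMeasurable)
    ((ae_restrict_iff' (m.isCompact_cell K).measurableSet).2 (ae_of_all _ fun x hx => ?_))
  exact (norm_inner_le_norm _ _).trans (mul_le_mul_of_nonneg_left (hC x hx) (norm_nonneg _))

end Source

end Mesh

/-! ### Solvability of one step -/

variable {d : ℕ} {O : Set (E d)} {m : Mesh O} {r r₁ r₂ : ℕ}

namespace Params

lemma quad_mem_Mh (q : Params) (τ : ℝ) (n : ℕ) (φ : ℕ → m.Mh r) :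
    (q.quad τ n m fun j => φ j) ∈ m.Mh r :=
  (m.Mh r).smul_mem _ ((m.Mh r).sum_mem fun j _ => (m.Mh r).smul_mem _ (φ j).2)

lemma quad_update (q : Params) (τ : ℝ) {n : ℕ} (hn : 1 ≤ n) (φ : ℕ → m.Mh r) (u : m.Mh r) :
    (q.quad τ n m fun j => Function.update φ n u j) =
      (q.quad τ n m fun j => Function.update φ n 0 j) + (τ * q.γ) • (u : m.Vec) := by
  obtain ⟨k, rfl⟩ := Nat.exists_eq_add_of_le' hn
  have hsum : ∀ u : m.Mh r,
      ∑ j ∈ Finset.Icc 1 k, q.β ((k + 1 : ℕ) * τ - j * τ) • (Function.update φ (k + 1) u j : m.Vec)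
        = ∑ j ∈ Finset.Icc 1 k, q.β ((k + 1 : ℕ) * τ - j * τ) • (φ j : m.Vec) := fun u =>
    Finset.sum_congr rfl fun j hj => by
      rw [Function.update_of_ne (by grind)]
  simp only [quad, Finset.sum_Icc_succ_top hn, hsum, Function.update_self]
  simp [β, mul_smul]

end Params

lemma omega_nonneg (ε : ℝ) : 0 ≤ omega ε := by
  unfold omega
  split_ifs <;> norm_num

namespace Mesh

lemma Aeps_self_nonneg (hd : 2 ≤ d) {ε σ : ℝ} (hσ : 0 < σ) (hvel : m.CoerciveVel r ε σ)
    {w : m.Vec} (hw : w ∈ m.Mh r) : 0 ≤ m.Aeps ε σ w w :=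
  (mul_nonneg (omega_nonneg ε) (m.normSqVec_nonneg hd hσ w)).trans (hvel w hw)

lemma Aeps_add_smul_left (ε σ c : ℝ) {u u' w : m.Vec} (hu : u ∈ m.Mh r) (hu' : u' ∈ m.Mh r)
    (hw : w ∈ m.Mh r) : m.Aeps ε σ (u + c • u') w = m.Aeps ε σ u w + c * m.Aeps ε σ u' w := by
  have hlin : IsLinearMap ℝ fun u : m.Mh r => m.Aeps ε σ u w :=
    isLinearMap_left (isBilinearMap_Aeps ε σ) (⟨w, hw⟩ : m.Mh r)
  have hadd := hlin.map_add ⟨u, hu⟩ (c • ⟨u', hu'⟩)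
  rwa [hlin.map_smul] at hadd

lemma existsUnique_velocity (hd : 2 ≤ d) {ε σ : ℝ} (hσ : 0 < σ) (hvel : m.CoerciveVel r ε σ)
    {z : m.Vec} (hz : z ∈ m.Mh r) {a c : ℝ} (ha : 0 ≤ a) (hc : 0 ≤ c) {l : m.Mh r → ℝ}
    (hl : IsLinearMap ℝ l) :
    ∃! u : m.Mh r, ∀ w : m.Mh r,
      m.innerVec u w + a * m.Ac z z u w + c * m.Aeps ε σ u w = l w := by
  refine existsUnique_isBilinearMap_eq (isBilinearMap_add (isBilinearMap_add isBilinearMap_innerVec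
    (isBilinearMap_const_mul (isBilinearMap_Ac z hz) a))
    (isBilinearMap_const_mul (isBilinearMap_Aeps ε σ) c)) (fun u hu => ?_) hl
  have hinner : 0 ≤ m.innerVec u u :=
    Finset.sum_nonneg fun K _ => integral_nonneg fun x => real_inner_self_nonneg
  have hAc := mul_nonneg ha (m.Ac_self_nonneg hd hz u.2)
  have hAeps := mul_nonneg hc (Aeps_self_nonneg hd hσ hvel u.2)
  exact Subtype.ext (eq_zero_of_innerVec_self u.2 (by linarith))

lemma existsUnique_potential (hd : 2 ≤ d) (hO : IsOpen O) (hO' : IsPreconnected O) {σ : ℝ}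
    (hσ : 0 < σ) (hsip : m.CoerciveSip r₂ σ) {w : m.Vec} (hw : w ∈ m.Mh r₁) (c : ℝ) :
    ∃! v : m.Ph0 r₂, ∀ g ∈ m.Ph0 r₂, m.Asip σ v g = c * m.b w g := by
  have hincl := (Submodule.inclusion (m.Ph0Submodule_le r₂)).isLinear
  have hB : IsBilinearMap ℝ fun v g : m.Ph0Submodule r₂ => m.Asip σ v g :=
    isBilinearMap_comp hincl hincl (isBilinearMap_Asip σ).toLinearMap
  have hl : IsLinearMap ℝ fun g : m.Ph0Submodule r₂ => c * m.b w g :=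
    isLinearMap_const_mul
      (isLinearMap_comp hincl (isBilinearMap_b.toLinearMap (⟨w, hw⟩ : m.Mh r₁))) c
  have hdef : ∀ g : m.Ph0Submodule r₂, m.Asip σ g g = 0 → g = 0 := fun g hg =>
    Subtype.ext (eq_zero_of_normSqScal hd hO hO' hσ g.2 (by linarith [hsip g g.2.1]))
  exact (existsUnique_congr fun v => Subtype.forall).1 (existsUnique_isBilinearMap_eq hB hdef hl)

lemma mem_Ph0_of_innerScal_one {p : m.Scal} (hp : p ∈ m.Ph r)
    (h : m.innerScal p (fun _ _ => 1) = 0) : p ∈ m.Ph0 r :=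
  ⟨hp, by simpa only [innerScal, mul_one] using h⟩

lemma innerScal_one_of_mem_Ph0 {p : m.Scal} (hp : p ∈ m.Ph0 r) :
    m.innerScal p (fun _ _ => 1) = 0 := by
  simpa only [innerScal, mul_one] using hp.2

lemma existsUnique_pressure (hd : 2 ≤ d) {w w' : m.Vec} (hw : w ∈ m.Mh r₁) (hw' : w' ∈ m.Mh r₁)
    (p v : m.Ph0 r₂) (c c' : ℝ) :
    ∃! s : m.Ph0 r₂, ∀ g ∈ m.Ph r₂,
      m.innerScal s g = m.innerScal p g + m.innerScal v g - c * m.b w g - c' * m.b w' g := by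
  have hinner : ∀ p : m.Ph0 r₂, IsLinearMap ℝ fun g : m.Ph r₂ => m.innerScal p g := fun p =>
    isLinearMap_right isBilinearMap_innerScal (⟨p, p.2.1⟩ : m.Ph r₂)
  have hb : ∀ w ∈ m.Mh r₁, IsLinearMap ℝ fun g : m.Ph r₂ => m.b w g := fun w hw =>
    isLinearMap_right isBilinearMap_b (⟨w, hw⟩ : m.Mh r₁)
  obtain ⟨s, hs, huniq⟩ := existsUnique_isBilinearMap_eq
    (isBilinearMap_innerScal (m := m) (r := r₂))
    (fun g hg => Subtype.ext (eq_zero_of_innerScal_self g.2 hg))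
    (isLinearMap_sub (isLinearMap_sub (isLinearMap_add (hinner p) (hinner v))
      (isLinearMap_const_mul (hb w hw) c)) (isLinearMap_const_mul (hb w' hw') c'))
  have hmean : (s : m.Scal) ∈ m.Ph0 r₂ := mem_Ph0_of_innerScal_one s.2 <| by
    rw [hs ⟨fun _ _ => 1, fun K => ⟨1, by simp, fun x => by simp⟩⟩,
      innerScal_one_of_mem_Ph0 p.2, innerScal_one_of_mem_Ph0 v.2, m.b_const_one hd hw,
      m.b_const_one hd hw']
    ring
  refine ⟨⟨s, hmean⟩, fun g hg => hs ⟨g, hg⟩, fun t ht => ?_⟩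
  have hts : (⟨t, t.2.1⟩ : m.Ph r₂) = s := huniq ⟨t, t.2.1⟩ fun g => ht g g.2
  exact Subtype.ext (congrArg (fun g : m.Ph r₂ => (g : m.Scal)) hts)

lemma existsUnique_correction (w : m.Mh r₁) (v : m.Ph r₂) (c : ℝ) :
    ∃! u : m.Mh r₁, ∀ w' ∈ m.Mh r₁, m.innerVec u w' = m.innerVec w w' + c * m.b w' v := by
  simpa only [Subtype.forall] using existsUnique_isBilinearMap_eq
    (isBilinearMap_innerVec (m := m) (r := r₁))
    (fun u hu => Subtype.ext (eq_zero_of_innerVec_self u.2 hu))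
    (isLinearMap_add (isLinearMap_right isBilinearMap_innerVec w)
      (isLinearMap_const_mul (isLinearMap_left isBilinearMap_b v) c))

end Mesh

open Mesh

lemma existsUnique_intermediate_velocity (hd : 2 ≤ d) (hO : volume (frontier O) = 0)
    (q : Params) {ε : ℝ} (hvel : m.CoerciveVel r₁ ε q.σ) {τ : ℝ} (hτ : 0 < τ) {n : ℕ}
    (hn : 1 ≤ n) {f : E d → E d} (hf : MemLp f 2 (volume.restrict O)) (hist : ℕ → m.Mh r₁)
    (u₀ : m.Mh r₁) (p₀ : m.Ph r₂) :
    ∃! ut : m.Mh r₁, ∀ w ∈ m.Mh r₁,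
      m.innerVec ut w + τ * m.Ac u₀ u₀ ut w + τ * q.μ * m.Aeps ε q.σ ut w
        + τ * m.Aeps ε q.σ (q.quad τ n m fun j => Function.update hist n ut j) w
      = m.innerVec u₀ w + τ * m.b w p₀ + τ * m.innerVec (fun _ => f) w := by
  set Q : m.Vec := q.quad τ n m fun j => Function.update hist n 0 j
  have hQ : Q ∈ m.Mh r₁ := q.quad_mem_Mh τ n _
  have hl : IsLinearMap ℝ fun w : m.Mh r₁ => m.innerVec u₀ w + τ * m.b w p₀
      + τ * m.innerVec (fun _ => f) w - τ * m.Aeps ε q.σ Q w :=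
    isLinearMap_sub (isLinearMap_add (isLinearMap_add
      (isLinearMap_right isBilinearMap_innerVec u₀)
      (isLinearMap_const_mul (isLinearMap_left isBilinearMap_b p₀) τ))
      (isLinearMap_const_mul (isLinearMap_innerVec_left (integrableOn_cell_of_memLp hO hf)) τ))
      (isLinearMap_const_mul
        (isLinearMap_right (isBilinearMap_Aeps ε q.σ) (⟨Q, hQ⟩ : m.Mh r₁)) τ)
  have hc : 0 ≤ τ * (q.μ + τ * q.γ) := by
    have := q.μ_pos
    have := q.γ_pos
    positivity
  refine (existsUnique_congr fun ut => ?_).1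
    (existsUnique_velocity hd q.σ_pos hvel u₀.2 hτ.le hc hl)
  rw [Subtype.forall]
  refine forall₂_congr fun w hw => ?_
  rw [q.quad_update τ hn, Aeps_add_smul_left ε q.σ _ hQ ut.2 hw]
  constructor <;> intro h <;> linarith

theorem uniquelySolvable_of_coercive (hd : 2 ≤ d) (hO : IsOpen O) (hO' : IsPreconnected O)
    (hO₀ : volume (frontier O) = 0) (q : Params) {ε : ℝ} (hvel : m.CoerciveVel r₁ ε q.σ)
    (hsip : m.CoerciveSip r₂ q.σ') {τ : ℝ} (hτ : 0 < τ) {n : ℕ} (hn : 1 ≤ n) :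
    UniquelySolvable m r₁ r₂ q ε τ n := by
  intro f hf hist u₀ p₀
  obtain ⟨ut, hut, hut'⟩ := existsUnique_intermediate_velocity hd hO₀ q hvel hτ hn hf hist u₀
    (⟨p₀, p₀.2.1⟩ : m.Ph r₂)
  obtain ⟨v, hv, hv'⟩ := existsUnique_potential hd hO hO' q.σ'_pos hsip ut.2 (-(1 / τ))
  obtain ⟨p, hp, hp'⟩ := existsUnique_pressure hd ut.2
    (q.quad_mem_Mh τ n (Function.update hist n ut)) p₀ v (q.δ * q.μ) q.δ
  obtain ⟨u, hu, hu'⟩ := existsUnique_correction ut (⟨v, v.2.1⟩ : m.Ph r₂) τ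
  refine ⟨(ut, u, p), ⟨v, hut, hv, hp, hu⟩, ?_⟩
  rintro ⟨ut₁, u₁, p₁⟩ ⟨v₁, h⟩
  obtain rfl := hut' ut₁ h.velocity
  obtain rfl := hv' v₁ h.potential
  obtain rfl := hp' p₁ h.pressure
  obtain rfl := hu' u₁ h.correction
  rfl

end DGOldroyd

end

open DGOldroyd MeasureTheory in
theorem lemma2_general (d : ℕ) (hd : 2 ≤ d) (r₁ r₂ : ℕ) (ρ : ℝ) (hρ : 0 < ρ) :
    (∃ σ₀ > 0, ∀ (O : Set (E d)) (m : Mesh O), m.ShapeRegular ρ →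
      (∀ σ, m.CoerciveVel r₁ 1 σ) ∧
      (∀ ε ∈ Set.Icc (-1) 1, ∀ σ ≥ σ₀, m.CoerciveVel r₁ ε σ) ∧
      (∀ σ' ≥ σ₀, m.CoerciveSip r₂ σ')) ∧
    ∀ (q : Params) (O : Set (E d)), IsOpen O → IsPreconnected O → volume (frontier O) = 0 →
      ∀ (m : Mesh O) (ε : ℝ), m.CoerciveVel r₁ ε q.σ → m.CoerciveSip r₂ q.σ' →
        ∀ τ > 0, ∀ n ≥ 1, UniquelySolvable m r₁ r₂ q ε τ n := by
  obtain ⟨σ₁, hσ₁, hvel⟩ := Mesh.exists_coerciveVel hd r₁ hρ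
  obtain ⟨σ₂, _, hsip⟩ := Mesh.exists_coerciveSip hd r₂ hρ
  refine ⟨⟨max σ₁ σ₂, lt_max_of_lt_left hσ₁, fun O m hm => ⟨m.coerciveVel_one r₁,
    fun ε hε σ hσ => hvel O m hm ε hε σ ((le_max_left _ _).trans hσ),
    fun σ' hσ' => hsip O m hm σ' ((le_max_right _ _).trans hσ')⟩⟩, ?_⟩
  exact fun q O hO hO' hO₀ m ε hvel hsip τ hτ n hn =>
    uniquelySolvable_of_coercive hd hO hO' hO₀ q hvel hsip hτ hn

open DGOldroyd in
theorem lemma2 (d : ℕ) (hd : d = 2 ∨ d = 3) (r₁ r₂ : ℕ) (hr₁ : 1 ≤ r₁)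
    (hr₂ : r₁ ≤ r₂ + 1) (hr₂' : r₂ ≤ r₁ + 1) (ρ : ℝ) (hρ : 0 < ρ) :
    -- the coercivity requirements hold for sufficiently large penalty parameters
    (∃ σ₀ > 0, ∀ (O : Set (E d)), IsConvexPolyhedralDomain O →
      ∀ m : Mesh O, m.ShapeRegular ρ →
        (∀ σ > 0, m.CoerciveVel r₁ 1 σ) ∧
        (∀ ε, ε = -1 ∨ ε = 0 → ∀ σ ≥ σ₀, m.CoerciveVel r₁ ε σ) ∧
        (∀ σ' ≥ σ₀, m.CoerciveSip r₂ σ')) ∧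
    -- under these requirements, every step of the scheme is uniquely solvable
    ∀ q : Params,
      (∀ (O : Set (E d)), IsConvexPolyhedralDomain O → ∀ m : Mesh O, m.ShapeRegular ρ →
        m.CoerciveVel r₁ (-1) q.σ → m.CoerciveSip r₂ q.σ' →
        ∀ τ > 0, ∀ n ≥ 1, UniquelySolvable m r₁ r₂ q (-1) τ n) ∧
      (∀ ε, ε = 0 ∨ ε = 1 → ∃ τ₀ > 0,
        ∀ (O : Set (E d)), IsConvexPolyhedralDomain O → ∀ m : Mesh O, m.ShapeRegular ρ →
          m.CoerciveVel r₁ ε q.σ → m.CoerciveSip r₂ q.σ' →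
          ∀ τ > 0, τ < τ₀ → ∀ n ≥ 1, UniquelySolvable m r₁ r₂ q ε τ n) := by
  obtain ⟨⟨σ₀, hσ₀, hcoercive⟩, hsolve⟩ := lemma2_general d (by omega) r₁ r₂ ρ hρ
  have hsolve' (q : Params) (O : Set (E d)) (hO : IsConvexPolyhedralDomain O) :=
    hsolve q O hO.isOpen hO.convex.isPreconnected (hO.convex.addHaar_frontier MeasureTheory.volume)
  refine ⟨⟨σ₀, hσ₀, fun O _ m hm => ?_⟩, fun q => ⟨fun O hO m _ => hsolve' q O hO m (-1),
    fun ε _ => ⟨1, one_pos, fun O hO m _ hvel hsip τ hτ _ => hsolve' q O hO m ε hvel hsip τ hτ⟩⟩⟩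
  obtain ⟨hone, hvel, hsip⟩ := hcoercive O m hm
  exact ⟨fun σ _ => hone σ, fun ε hε => hvel ε (by rcases hε with rfl | rfl <;> norm_num), hsip⟩
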